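/- Throughout, $G=(V,E)$ is a finite, simple, connected graph with $n=|V|\ge 2$ vertices and $m=|E|$ edges. The lazy random walk on $G$ stays at its current vertex with probability $1/2$ and otherwise moves to a uniformly random neighbour. Its stationary distribution is $\pi(v)=d(v)/(2m)$, where $d(v)$ is the degree of $v$, and $\pi_{\min}=\min_v\pi(v)$. Let $\lambda_2$ be the second largest eigenvalue of its transition matrix (counted with multiplicity) and $t_{\mathrm{rel}}(G)=1/(1-\lambda_2)$. For $k$ independent lazy random walks on $G$, let $\tau^{(k)}_{\mathrm{cov}}$ be the first time by which every vertex has been visited by at least one of the walks. Let $$t^{(k)}_{\mathrm{cov}}(G)=\max_{u_1,\dots,u_k\in V}\mathbb{E}_{u_1,\dots,u_k}\bigl[\tau^{(k)}_{\mathrm{cov}}\bigr],\qquad t^{(k)}_{\mathrm{cov}}(\pi,G)=\mathbb{E}_{\pi^k}\bigl[\tau^{(k)}_{\mathrm{cov}}\bigr]$$ be the cover times of $k$ walks from worst-case start vertices and from independent start vertices with law $\pi$. Theorem. For any expander with $\pi_{\min}=\Omega(1/n)$ and any $1\le k\le n$, $$t^{(k)}_{\mathrm{cov}}=\Theta\bigl(t^{(k)}_{\mathrm{cov}}(\pi)\bigr)=\Theta\Bigl(\frac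 nk\log n\Bigr).$$ Precisely: for all real $C,c>0$ there are $a,b>0$, depending only on $C$ and $c$, such that every finite simple connected graph $G$ with $n\ge 2$ vertices, $t_{\mathrm{rel}}(G)\le C$ and $\pi_{\min}\ge c/n$ (regular or not) satisfies, for every integer $1\le k\le n$, $$a\,\frac nk\log n\le t^{(k)}_{\mathrm{cov}}(\pi,G)\le b\,\frac nk\log n,\qquad a\,\frac nk\log n\le t^{(k)}_{\mathrm{cov}}(G)\le b\,\frac nk\log n,$$ and $$a\,t^{(k)}_{\mathrm{cov}}(\pi,G)\le t^{(k)}_{\mathrm{cov}}(G)\le b\,t^{(k)}_{\mathrm{cov}}(\pi,G).$$ -/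

import Mathlib

open MeasureTheory ProbabilityTheory
open scoped ENNReal

namespace MultiWalk

section Chain

variable {V : Type*} [Fintype V] [DecidableEq V]

/-- Transition matrix of the lazy random walk on `G`: stay put with probability `1/2`, otherwise
move to a uniformly random neighbour. (By convention a walk at an isolated vertex never moves;
a connected graph with at least two vertices has no such vertex.) -/
noncomputable def transition (G : SimpleGraph V) [DecidableRel G.Adj] : Matrix V V ℝ :=
  fun v w =>
    if G.degree v = 0 then (if v = w then 1 else 0)
    else (1 / 2) * (if v = w then 1 else 0) +
      (1 / 2) * (if G.Adj v w then 1 / (G.degree v : ℝ) else 0)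

/-- The eigenvalues of the transition matrix, repeated according to algebraic multiplicity, in
decreasing order. -/
noncomputable def eigenvalueList (G : SimpleGraph V) [DecidableRel G.Adj] : List ℝ :=
  (transition G).charpoly.roots.sort (fun x y => y ≤ x)

/-- The second largest eigenvalue `λ₂` of the transition matrix. -/
noncomputable def lambdaTwo (G : SimpleGraph V) [DecidableRel G.Adj] : ℝ :=
  (eigenvalueList G).getD 1 0

/-- The relaxation time `1 / (1 - λ₂)`. -/
noncomputable def relaxationTime (G : SimpleGraph V) [DecidableRel G.Adj] : ℝ :=
  1 / (1 - lambdaTwo G)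

/-- The stationary distribution `π(v) = d(v) / (2m)`. -/
noncomputable def stationary (G : SimpleGraph V) [DecidableRel G.Adj] (v : V) : ℝ :=
  (G.degree v : ℝ) / (2 * (G.edgeFinset.card : ℝ))

/-- `π_min`, the smallest stationary probability. -/
noncomputable def stationaryMin (G : SimpleGraph V) [DecidableRel G.Adj] : ℝ :=
  ⨅ v : V, stationary G v

lemma transition_nonneg (G : SimpleGraph V) [DecidableRel G.Adj] (v w : V) :
    0 ≤ transition G v w := by
  unfold transition
  split_ifs <;> positivity

lemma sum_transition (G : SimpleGraph V) [DecidableRel G.Adj] (v : V) :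
    ∑ w, transition G v w = 1 := by
  unfold transition
  by_cases h : G.degree v = 0
  · simp [h]
  · have h' : (G.degree v : ℝ) ≠ 0 := by exact_mod_cast h
    simp only [h, if_false]
    rw [Finset.sum_add_distrib, ← Finset.mul_sum, ← Finset.mul_sum, Finset.sum_ite_eq,
      ← Finset.sum_filter, Finset.sum_const, ← SimpleGraph.neighborFinset_eq_filter,
      SimpleGraph.card_neighborFinset_eq_degree, nsmul_eq_mul]
    simp only [Finset.mem_univ, if_true]
    field_simp
    norm_num

variable [MeasurableSpace V]

/-- The law of one step of the lazy walk from `v`. -/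
noncomputable def stepLaw (G : SimpleGraph V) [DecidableRel G.Adj] (v : V) : Measure V :=
  ∑ w, ENNReal.ofReal (transition G v w) • Measure.dirac w

instance (G : SimpleGraph V) [DecidableRel G.Adj] (v : V) :
    IsProbabilityMeasure (stepLaw G v) := by
  constructor
  simp only [stepLaw, Measure.coe_finsetSum, Finset.sum_apply, Measure.smul_apply,
    measure_univ, smul_eq_mul, mul_one]
  rw [← ENNReal.ofReal_sum_of_nonneg fun w _ => transition_nonneg G v w, sum_transition,
    ENNReal.ofReal_one]

/-- The stationary distribution as a measure on `V`. -/
noncomputable def stationaryLaw (G : SimpleGraph V) [DecidableRel G.Adj] : Measure V :=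
  ∑ v, ENNReal.ofReal (stationary G v) • Measure.dirac v

variable [MeasurableSingletonClass V]

/-- Given the history up to time `t`, the next vertex has the law of one step from the vertex
occupied at time `t`. -/
noncomputable def stepKernel (G : SimpleGraph V) [DecidableRel G.Adj] (t : ℕ) :
    Kernel (Π _ : Finset.Iic t, V) V :=
  (Kernel.ofFunOfCountable (stepLaw G)).comap (fun x => x ⟨t, Finset.mem_Iic.2 le_rfl⟩)
    (measurable_pi_apply _)

instance (G : SimpleGraph V) [DecidableRel G.Adj] (t : ℕ) :
    IsMarkovKernel (stepKernel G t) :=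
  ⟨fun x => inferInstanceAs
    (IsProbabilityMeasure (stepLaw G (x ⟨t, Finset.mem_Iic.2 le_rfl⟩)))⟩

/-- The law on trajectories `ℕ → V` of the lazy random walk with initial distribution `μ`. -/
noncomputable def walkLaw (G : SimpleGraph V) [DecidableRel G.Adj] (μ : Measure V) :
    Measure (ℕ → V) :=
  Kernel.trajMeasure (X := fun _ => V) μ (stepKernel G)

/-- The cover time `τ_cov^{(k)}` of the trajectories `X 0, …, X (k-1)`: the first time `t` by which
every vertex has been visited by some walk, and `∞` if there is no such time. -/
noncomputable def coverTime {k : ℕ} (X : Fin k → ℕ → V) : ℝ≥0∞ :=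
  ⨅ (t : ℕ) (_ : ∀ v : V, ∃ i : Fin k, ∃ s ≤ t, X i s = v), (t : ℝ≥0∞)

/-- The expected cover time of `k` independent lazy random walks, the `i`-th of which has initial
distribution `μ i`. -/
noncomputable def expectedCoverTime (G : SimpleGraph V) [DecidableRel G.Adj] {k : ℕ}
    (μ : Fin k → Measure V) : ℝ≥0∞ :=
  ∫⁻ X, coverTime X ∂(Measure.pi fun i => walkLaw G (μ i))

/-- The worst-case cover time `t_cov^{(k)}`: the maximum over the start vertices
`u₁, …, u_k` of the expected cover time. -/
noncomputable def worstCoverTime (G : SimpleGraph V) [DecidableRel G.Adj] (k : ℕ) : ℝ≥0∞ :=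
  ⨆ u : Fin k → V, expectedCoverTime G fun i => Measure.dirac (u i)

/-- The stationary cover time `t_cov^{(k)}(π)`: the start vertices are independent with law `π`. -/
noncomputable def stationaryCoverTime (G : SimpleGraph V) [DecidableRel G.Adj] (k : ℕ) : ℝ≥0∞ :=
  expectedCoverTime G fun _ : Fin k => stationaryLaw G

end Chain

end MultiWalk

set_option linter.unusedSectionVars false

/-! Both directions rest on ℓ²(π) estimates for a reversible chain with nonnegative spectrum and gap
γ (`IsGapChain`). `reversible_gap` diagonalizes the matrix conjugated by √π, which turns the bound
on the relaxation time into such a gap; laziness gives nonnegativity of the spectrum.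

Upper bound. Killing the chain at v multiplies the ℓ²(π) norm of the survival function by at most 1
- γπ(v) per step (`nsq_survive_le`). A burn-in of order log n makes every start as good as
stationarity up to a factor 1 + 1/n, so a walk avoids v for t further steps with probability at most
(1 - γc/n)^t (1 + 1/n). For k ≤ n independent walks the factors 1 + 1/n multiply to at most 3, and a
union bound over v gives a geometric tail beyond a time of order (n/k) log n
(`expectedCoverTime_le`).

Lower bound. Reveal k stationary walks one after the other and follow the unvisited part U of the
set of vertices with π(v) ≤ 2/n, which contains at least half of all vertices. The potential
1/max(|U|, h) starts at or below 2/n and equals 1/h once the graph is covered. During L ≤ h steps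
from any vertex, the expected number of visits to U is at most 2L|U|/n plus a mixing error O(√|U|).
Hence the expected potential grows by a factor of at most 1 + 4L/n + O(1/√h); the truncation at h
keeps the error small. With h = n^{3/4}, L its integer part and kt ≤ (n log n)/32, the main terms
contribute a constant times n^{1/8} and the errors only a constant factor. Markov's inequality then
bounds the probability of covering by a constant times n^{-1/8} (`measure_covered_le`). Small n are
settled at time 0, and the worst start is at least as bad as the stationary average. -/

namespace MultiWalk

/-! ### Second eigenvalue of a reversible matrix -/

section Spectral

variable {V : Type*} [Fintype V] [DecidableEq V]

/-- The conjugate of a matrix `P` by the diagonal matrix with entries `√π`. -/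
noncomputable def symmetrization (P : Matrix V V ℝ) (π : V → ℝ) : Matrix V V ℝ :=
  fun v w => √(π v) * P v w * (√(π w))⁻¹

lemma symmetrization_isHermitian {P : Matrix V V ℝ} {π : V → ℝ} (hπ : ∀ v, 0 < π v)
    (hrev : ∀ v w, π v * P v w = π w * P w v) : (symmetrization P π).IsHermitian := by
  ext v w
  simp only [symmetrization, Matrix.conjTranspose_apply, star_trivial]
  have hv := Real.sqrt_pos.2 (hπ v)
  have hw := Real.sqrt_pos.2 (hπ w)
  have h1 := Real.mul_self_sqrt (hπ v).le
  have h2 := Real.mul_self_sqrt (hπ w).le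
  have := hrev v w
  field_simp
  rw [pow_two, pow_two, h1, h2]
  linarith

/-- Similarity preserves eigenvalues with multiplicity, so λ₂ of the non-symmetric `P` can be read
off a Hermitian matrix. -/
lemma charpoly_symmetrization {P : Matrix V V ℝ} {π : V → ℝ} (hπ : ∀ v, 0 < π v) :
    (symmetrization P π).charpoly = P.charpoly := by
  have hne : ∀ v, √(π v) ≠ 0 := fun v => (Real.sqrt_pos.2 (hπ v)).ne'
  let M : (Matrix V V ℝ)ˣ :=
    ⟨Matrix.diagonal fun v => √(π v), Matrix.diagonal fun v => (√(π v))⁻¹,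
      by simp [Matrix.diagonal_mul_diagonal, hne], by simp [Matrix.diagonal_mul_diagonal, hne]⟩
  have h : symmetrization P π = M.val * P * M⁻¹.val := by
    ext v w
    change _ = (Matrix.diagonal (fun v => √(π v)) * P * Matrix.diagonal fun v => (√(π v))⁻¹) v w
    rw [Matrix.mul_diagonal, Matrix.diagonal_mul, symmetrization]
  rw [h, Matrix.coe_units_inv, Matrix.charpoly_units_conj]

lemma form_symmetrization {P : Matrix V V ℝ} {π : V → ℝ} (hπ : ∀ v, 0 < π v) (f : V → ℝ) :
    ∑ v, (√(π v) * f v) * (symmetrization P π).mulVec (fun w => √(π w) * f w) v =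
      ∑ v, π v * (f v * ∑ w, P v w * f w) := by
  refine Finset.sum_congr rfl fun v _ => ?_
  have : (symmetrization P π).mulVec (fun w => √(π w) * f w) v = √(π v) * ∑ w, P v w * f w := by
    simp only [Matrix.mulVec, dotProduct, symmetrization, Finset.mul_sum]
    refine Finset.sum_congr rfl fun w _ => ?_
    have := (Real.sqrt_pos.2 (hπ w)).ne'
    field_simp
  rw [this]
  nth_rewrite 3 [← Real.mul_self_sqrt (hπ v).le]
  ring

/-- For a Hermitian matrix, the quadratic form is diagonal in the eigenvector basis. -/
lemma form_eq_sum_eigenvalues {S : Matrix V V ℝ} (hS : S.IsHermitian) (x : V → ℝ) :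
    ∑ v, x v * S.mulVec x v =
      ∑ i, hS.eigenvalues i * (inner ℝ (hS.eigenvectorBasis i) (WithLp.toLp 2 x)) ^ 2 := by
  have h1 : ∑ v, x v * S.mulVec x v
      = inner ℝ (WithLp.toLp 2 x : EuclideanSpace ℝ V) (WithLp.toLp 2 (S.mulVec x)) := by
    simp [PiLp.inner_apply, mul_comm]
  rw [h1, ← (hS.eigenvectorBasis).sum_inner_mul_inner]
  refine Finset.sum_congr rfl fun i _ => ?_
  have h2 : inner ℝ (hS.eigenvectorBasis i) (WithLp.toLp 2 (S.mulVec x)) =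
      hS.eigenvalues i * inner ℝ (hS.eigenvectorBasis i) (WithLp.toLp 2 x) := by
    have h3 : ∀ y z : V → ℝ, inner ℝ (WithLp.toLp 2 y : EuclideanSpace ℝ V) (WithLp.toLp 2 z)
        = dotProduct y z := by
      intro y z; simp [PiLp.inner_apply, dotProduct, mul_comm]
    have h4 := h3 (hS.eigenvectorBasis i).ofLp
    simp only [WithLp.toLp_ofLp] at h4
    rw [h4, h4, Matrix.dotProduct_mulVec, ← Matrix.mulVec_transpose]
    have hT : S.transpose = S := by simpa using hS.eq
    rw [hT, hS.mulVec_eigenvectorBasis, smul_dotProduct, smul_eq_mul]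
  rw [h2, real_inner_comm]
  ring

lemma sum_sq_eq_sum_inner {S : Matrix V V ℝ} (hS : S.IsHermitian) (x : V → ℝ) :
    ∑ v, x v ^ 2 = ∑ i, (inner ℝ (hS.eigenvectorBasis i) (WithLp.toLp 2 x)) ^ 2 := by
  have h1 : ∑ v, x v ^ 2
      = inner ℝ (WithLp.toLp 2 x : EuclideanSpace ℝ V) (WithLp.toLp 2 x) := by
    simp [PiLp.inner_apply, pow_two, -inner_self_eq_norm_sq_to_K]
  rw [h1, ← (hS.eigenvectorBasis).sum_inner_mul_inner]
  refine Finset.sum_congr rfl fun i _ => ?_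
  rw [real_inner_comm]
  ring

lemma sort_roots_charpoly {S : Matrix V V ℝ} (hS : S.IsHermitian) :
    S.charpoly.roots.sort (fun x y => y ≤ x) = List.ofFn hS.eigenvalues₀ := by
  have := hS.sort_roots_charpoly_eq_eigenvalues₀
  simpa using this

/-- The variational characterization of the second eigenvalue of a reversible chain for which only
constant functions have vanishing energy. -/
theorem reversible_gap {P : Matrix V V ℝ} {π : V → ℝ} (hπ : ∀ v, 0 < π v)
    (hrev : ∀ v w, π v * P v w = π w * P w v) (hrow : ∀ v, ∑ w, P v w = 1)
    (hirr : ∀ f : V → ℝ, ∑ v, π v * f v ^ 2 ≤ ∑ v, π v * (f v * ∑ w, P v w * f w) →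
      ∀ v w, f v = f w)
    (hcard : 2 ≤ Fintype.card V) :
    (P.charpoly.roots.sort (fun x y => y ≤ x)).getD 1 0 < 1 ∧
    ∀ f : V → ℝ, ∑ v, π v * f v = 0 → ∑ v, π v * (f v * ∑ w, P v w * f w) ≤
      (P.charpoly.roots.sort (fun x y => y ≤ x)).getD 1 0 * ∑ v, π v * f v ^ 2 := by
  set S := symmetrization P π with hSdef
  have hS : S.IsHermitian := symmetrization_isHermitian hπ hrev
  have hl : (P.charpoly.roots.sort (fun x y => y ≤ x)).getD 1 0 =
      hS.eigenvalues₀ ⟨1, hcard⟩ := by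
    rw [← charpoly_symmetrization hπ, sort_roots_charpoly hS, List.getD_eq_getElem _ _ (by simpa)]
    simp
  rw [hl]
  set l := hS.eigenvalues₀ ⟨1, hcard⟩ with hldef
  have hsq : ∀ f : V → ℝ, ∑ v, π v * f v ^ 2 = ∑ v, (√(π v) * f v) ^ 2 := by
    intro f
    refine Finset.sum_congr rfl fun v _ => ?_
    rw [mul_pow, Real.sq_sqrt (hπ v).le]
  set e : Fin (Fintype.card V) ≃ V := Fintype.equivOfCardEq (Fintype.card_fin _) with he
  have hev : ∀ j, hS.eigenvalues (e j) = hS.eigenvalues₀ j := by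
    intro j; simp [Matrix.IsHermitian.eigenvalues, he]
  let j0 : Fin (Fintype.card V) := ⟨0, by omega⟩
  let j1 : Fin (Fintype.card V) := ⟨1, hcard⟩
  have hle : ∀ i, i ≠ e j0 → hS.eigenvalues i ≤ l := by
    intro i hi
    obtain ⟨j, rfl⟩ := e.surjective i
    rw [hev]
    refine hS.eigenvalues₀_antitone ?_
    rw [Fin.le_def]
    have : j ≠ j0 := fun h => hi (by rw [h])
    have h0 : (j : ℕ) ≠ 0 := fun h => this (Fin.ext h)
    simp; omega
  have hsp : ∀ v, 0 < √(π v) := fun v => Real.sqrt_pos.2 (hπ v)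
  -- eigenvectors with eigenvalue at least one are multiples of `√π`
  have hconst : ∀ i, 1 ≤ hS.eigenvalues i → ∃ c, ∀ v, hS.eigenvectorBasis i v = c * √(π v) := by
    intro i hi
    set b := hS.eigenvectorBasis i with hb
    let f : V → ℝ := fun v => b v * (√(π v))⁻¹
    have hf : (fun v => √(π v) * f v) = b.ofLp := by
      ext v
      have := (hsp v).ne'
      simp only [f]; field_simp
    have h1 := form_symmetrization (P := P) hπ f
    have h2 := hsq f
    have hf' : ∀ v, √(π v) * f v = b v := fun v => congrFun hf v
    simp only [hf'] at h1 h2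
    have hn : ∑ v, b v ^ 2 = 1 := by
      have := hS.eigenvectorBasis.orthonormal.1 i
      rw [← hb, EuclideanSpace.norm_eq, Real.sqrt_eq_one] at this
      simpa using this
    have h3 : ∑ v, b v * (symmetrization P π).mulVec b.ofLp v = hS.eigenvalues i := by
      rw [← hSdef, hS.mulVec_eigenvectorBasis]
      simp only [Pi.smul_apply, smul_eq_mul]
      rw [← mul_one (hS.eigenvalues i), ← hn, Finset.mul_sum]
      refine Finset.sum_congr rfl fun v _ => ?_
      rw [← Finset.mul_sum, hn, ← hb]
      ring
    have hc := hirr f (by rw [h2, ← h1, h3, hn]; exact hi)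
    refine ⟨f (e j0), fun v => ?_⟩
    rw [hc (e j0) v, mul_comm]
    exact (hf' v).symm
  -- If the top two eigenvalues were both at least 1, two orthonormal eigenvectors would be
  -- multiples of the same positive vector √π.
  have hlt : l < 1 := by
    by_contra hge
    push Not at hge
    have h1 : 1 ≤ hS.eigenvalues (e j1) := by rw [hev]; exact hge
    have h0 : 1 ≤ hS.eigenvalues (e j0) := by
      rw [hev]; exact hge.trans (hS.eigenvalues₀_antitone (by simp [j0]))
    obtain ⟨c0, hc0⟩ := hconst _ h0
    obtain ⟨c1, hc1⟩ := hconst _ h1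
    have hne : e j0 ≠ e j1 := fun h => by simpa [j0, j1] using e.injective h
    have horth := hS.eigenvectorBasis.orthonormal.2 hne
    have hn0 := hS.eigenvectorBasis.orthonormal.1 (e j0)
    have hn1 := hS.eigenvectorBasis.orthonormal.1 (e j1)
    have hpos : 0 < ∑ v, π v :=
      Finset.sum_pos (fun v _ => hπ v) ⟨e j0, Finset.mem_univ _⟩
    have key : c0 * c1 * ∑ v, π v = 0 := by
      rw [← horth, PiLp.inner_apply, Finset.mul_sum]
      refine Finset.sum_congr rfl fun v _ => ?_
      rw [hc0, hc1]
      nth_rewrite 1 [← Real.mul_self_sqrt (hπ v).le]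
      simp; ring_nf
    rcases mul_eq_zero.1 key with h | h
    · rcases mul_eq_zero.1 h with h | h
      · have : hS.eigenvectorBasis (e j0) = 0 := by ext v; simp [hc0, h]
        rw [this] at hn0; simp at hn0
      · have : hS.eigenvectorBasis (e j1) = 0 := by ext v; simp [hc1, h]
        rw [this] at hn1; simp at hn1
    · exact hpos.ne' h
  refine ⟨hlt, fun f hf => ?_⟩
  set x : V → ℝ := fun v => √(π v) * f v with hx
  rw [← form_symmetrization hπ f, hsq f, ← hSdef, form_eq_sum_eigenvalues hS x,
    sum_sq_eq_sum_inner hS x, Finset.mul_sum]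
  set s : V → ℝ := fun v => √(π v) with hs
  have hSs : S.mulVec s = s := by
    ext v
    simp only [Matrix.mulVec, dotProduct, hSdef, symmetrization, hs]
    have : ∀ w, √(π v) * P v w * (√(π w))⁻¹ * √(π w) = √(π v) * P v w := by
      intro w; have := (hsp w).ne'; field_simp
    simp only [this, ← Finset.mul_sum, hrow, mul_one]
  have h3 : ∀ y z : V → ℝ, inner ℝ (WithLp.toLp 2 y : EuclideanSpace ℝ V) (WithLp.toLp 2 z)
      = dotProduct y z := by
    intro y z; simp [PiLp.inner_apply, dotProduct, mul_comm]
  -- √π has eigenvalue 1, every basis vector other than the first has eigenvalue at most l < 1, and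
  -- eigenspaces of distinct eigenvalues are orthogonal.
  have horth : ∀ i, i ≠ e j0 → inner ℝ (hS.eigenvectorBasis i) (WithLp.toLp 2 s) = 0 := by
    intro i hi
    have h4 := h3 (hS.eigenvectorBasis i).ofLp s
    simp only [WithLp.toLp_ofLp] at h4
    have h5 : (hS.eigenvectorBasis i).ofLp ⬝ᵥ s =
        hS.eigenvalues i * (hS.eigenvectorBasis i).ofLp ⬝ᵥ s := by
      have hT : S.transpose = S := by simpa using hS.eq
      conv_lhs => rw [← hSs]
      rw [Matrix.dotProduct_mulVec, ← Matrix.mulVec_transpose, hT,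
        hS.mulVec_eigenvectorBasis, smul_dotProduct, smul_eq_mul]
    rw [h4]
    have := hle i hi
    have h6 : (1 - hS.eigenvalues i) * ((hS.eigenvectorBasis i).ofLp ⬝ᵥ s) = 0 := by linarith
    exact (mul_eq_zero.1 h6).resolve_left (by linarith)
  -- Mean zero for `f` says that `x` is orthogonal to √π, which by `horth` is a nonzero multiple of
  -- the first basis vector.
  have hzero : inner ℝ (hS.eigenvectorBasis (e j0)) (WithLp.toLp 2 x) = 0 := by
    have h7 : inner ℝ (WithLp.toLp 2 s : EuclideanSpace ℝ V) (WithLp.toLp 2 x) = 0 := by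
      rw [h3, ← hf, dotProduct]
      refine Finset.sum_congr rfl fun v _ => ?_
      simp only [hs, hx]
      rw [← mul_assoc, Real.mul_self_sqrt (hπ v).le]
    rw [← hS.eigenvectorBasis.sum_inner_mul_inner, Finset.sum_eq_single (e j0)] at h7
    · rcases mul_eq_zero.1 h7 with h | h
      · exfalso
        have h8 : ∑ v, s v ^ 2 = 0 := by
          rw [sum_sq_eq_sum_inner hS s]
          refine Finset.sum_eq_zero fun i _ => ?_
          by_cases hi : i = e j0
          · rw [hi, real_inner_comm, h]; simp
          · rw [horth i hi]; simp
        have h9 : 0 < ∑ v, s v ^ 2 :=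
          Finset.sum_pos (fun v _ => pow_pos (hsp v) 2) ⟨e j0, Finset.mem_univ _⟩
        exact h9.ne' h8
      · exact h
    · intro i _ hi
      rw [real_inner_comm, horth i hi, zero_mul]
    · simp
  refine Finset.sum_le_sum fun i _ => ?_
  by_cases hi : i = e j0
  · rw [hi, hzero]; simp
  · exact mul_le_mul_of_nonneg_right (hle i hi) (sq_nonneg _)

end Spectral

/-! ### ℓ² contraction and survival probabilities -/

section GapChain

variable {V : Type*} [Fintype V] [DecidableEq V]

/-- The averaging operator of a transition matrix. -/
def avg (P : Matrix V V ℝ) (f : V → ℝ) (v : V) : ℝ := ∑ w, P v w * f w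

/-- The mean of `f` under the weights `π`. -/
def wmean (π : V → ℝ) (f : V → ℝ) : ℝ := ∑ v, π v * f v

/-- The squared norm of `f` in `ℓ²(π)`. -/
def nsq (π : V → ℝ) (f : V → ℝ) : ℝ := ∑ v, π v * f v ^ 2

/-- The bilinear form `⟨f, P g⟩` on `ℓ²(π)`. -/
def form (π : V → ℝ) (P : Matrix V V ℝ) (f g : V → ℝ) : ℝ := ∑ v, π v * (f v * avg P g v)

/-- A reversible transition matrix with nonnegative spectrum, stationary distribution `π` and
spectral gap at least `γ`. -/
structure IsGapChain (P : Matrix V V ℝ) (π : V → ℝ) (γ : ℝ) : Prop where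
  nonneg : ∀ v w, 0 ≤ P v w
  row_sum : ∀ v, ∑ w, P v w = 1
  pos : ∀ v, 0 < π v
  sum_eq_one : ∑ v, π v = 1
  reversible : ∀ v w, π v * P v w = π w * P w v
  gap_pos : 0 < γ
  gap_le_one : γ ≤ 1
  form_nonneg : ∀ f, 0 ≤ form π P f f
  form_le : ∀ f, wmean π f = 0 → form π P f f ≤ (1 - γ) * nsq π f

variable {P : Matrix V V ℝ} {π : V → ℝ} {γ : ℝ}

lemma avg_mono (hP : ∀ v w, 0 ≤ P v w) {f g : V → ℝ} (h : ∀ v, f v ≤ g v) (v : V) :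
    avg P f v ≤ avg P g v :=
  Finset.sum_le_sum fun w _ => mul_le_mul_of_nonneg_left (h w) (hP v w)

lemma avg_sub_const (hrow : ∀ v, ∑ w, P v w = 1) (f : V → ℝ) (a : ℝ) :
    avg P (fun v => f v - a) = fun v => avg P f v - a := by
  ext v
  simp only [avg, mul_sub, Finset.sum_sub_distrib, ← Finset.sum_mul, hrow, one_mul]

lemma iterate_avg_sub_const (hrow : ∀ v, ∑ w, P v w = 1) (f : V → ℝ) (a : ℝ) (s : ℕ) :
    (avg P)^[s] (fun v => f v - a) = fun v => (avg P)^[s] f v - a := by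
  induction s with
  | zero => rfl
  | succ s ih => rw [Function.iterate_succ_apply', ih, avg_sub_const hrow,
      Function.iterate_succ_apply']

lemma nsq_nonneg (hπ : ∀ v, 0 < π v) (f : V → ℝ) : 0 ≤ nsq π f :=
  Finset.sum_nonneg fun v _ => mul_nonneg (hπ v).le (sq_nonneg _)

lemma mul_sq_le_nsq (hπ : ∀ v, 0 < π v) (f : V → ℝ) (x : V) : π x * f x ^ 2 ≤ nsq π f :=
  Finset.single_le_sum (f := fun v => π v * f v ^ 2)
    (fun v _ => mul_nonneg (hπ v).le (sq_nonneg _)) (Finset.mem_univ x)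

lemma sq_wmean_le (hπ : ∀ v, 0 < π v) (s : Finset V) (f : V → ℝ) :
    (∑ v ∈ s, π v * f v) ^ 2 ≤ (∑ v ∈ s, π v) * ∑ v ∈ s, π v * f v ^ 2 := by
  refine Finset.sum_sq_le_sum_mul_sum_of_sq_le_mul s (fun v _ => (hπ v).le)
    (fun v _ => mul_nonneg (hπ v).le (sq_nonneg _)) fun v _ => le_of_eq ?_
  ring

namespace IsGapChain

variable (hc : IsGapChain P π γ)
include hc

lemma wmean_avg (f : V → ℝ) : wmean π (avg P f) = wmean π f := by
  simp only [wmean, avg, Finset.mul_sum]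
  rw [Finset.sum_comm]
  refine Finset.sum_congr rfl fun w _ => ?_
  have : ∀ v, π v * (P v w * f w) = P w v * (π w * f w) := by
    intro v; rw [← mul_assoc, hc.reversible]; ring
  simp only [this, ← Finset.sum_mul, hc.row_sum, one_mul]

lemma wmean_iterate_avg (f : V → ℝ) (s : ℕ) : wmean π ((avg P)^[s] f) = wmean π f := by
  induction s with
  | zero => rfl
  | succ s ih => rw [Function.iterate_succ_apply', hc.wmean_avg, ih]

lemma form_comm (f g : V → ℝ) : form π P f g = form π P g f := by
  simp only [form, avg, Finset.mul_sum]
  rw [Finset.sum_comm]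
  refine Finset.sum_congr rfl fun w _ => Finset.sum_congr rfl fun v _ => ?_
  have := hc.reversible v w
  calc π v * (f v * (P v w * g w)) = (π v * P v w) * (f v * g w) := by ring
    _ = (π w * P w v) * (f v * g w) := by rw [this]
    _ = _ := by ring

/-- Cauchy–Schwarz for a positive semidefinite form, from the discriminant of t ↦ ⟨f + tg, P(f +
tg)⟩. This is where nonnegativity of the spectrum is used. -/
lemma form_sq_le (f g : V → ℝ) : form π P f g ^ 2 ≤ form π P f f * form π P g g := by
  have h : ∀ t : ℝ, 0 ≤ form π P g g * (t * t) + 2 * form π P f g * t + form π P f f := by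
    intro t
    have h1 := hc.form_nonneg fun v => f v + t * g v
    have h2 : form π P (fun v => f v + t * g v) (fun v => f v + t * g v) =
        form π P g g * (t * t) + (form π P f g + form π P g f) * t + form π P f f := by
      have h3 : ∀ v, avg P (fun v => f v + t * g v) v = avg P f v + t * avg P g v := by
        intro v
        simp only [avg, Finset.mul_sum, ← Finset.sum_add_distrib]
        refine Finset.sum_congr rfl fun w _ => by ring
      simp only [form, h3, Finset.sum_mul, ← Finset.sum_add_distrib]
      refine Finset.sum_congr rfl fun w _ => by ring
    rw [h2, ← hc.form_comm f g] at h1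
    linarith
  have := discrim_le_zero h
  rw [discrim] at this
  linarith

/-- If `g` satisfies `⟨g, P f⟩ = ‖g‖²` and the form is bounded by `r` at `f` and `g`, then
`‖g‖ ≤ r ‖f‖`. -/
lemma nsq_le_of_form_le {f g : V → ℝ} {r : ℝ} (h : form π P g f = nsq π g)
    (hf : form π P f f ≤ r * nsq π f) (hg : form π P g g ≤ r * nsq π g) :
    nsq π g ≤ r ^ 2 * nsq π f := by
  have h1 := hc.form_sq_le g f
  rw [h] at h1
  have hf0 := hc.form_nonneg f
  have hg0 := hc.form_nonneg g
  rcases (nsq_nonneg hc.pos g).eq_or_lt with h0 | h0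
  · rw [← h0]; exact mul_nonneg (sq_nonneg _) (nsq_nonneg hc.pos f)
  · have h2 : form π P g g * form π P f f ≤ (r * nsq π g) * (r * nsq π f) :=
      mul_le_mul hg hf hf0 (hg0.trans hg)
    have h3 : nsq π g * nsq π g ≤ (r ^ 2 * nsq π f) * nsq π g := by nlinarith
    exact le_of_mul_le_mul_right h3 h0

/-- Take g = Pf in `nsq_le_of_form_le`; averaging preserves mean zero, so the gap applies to both
functions. -/
lemma nsq_avg_le {f : V → ℝ} (hf : wmean π f = 0) :
    nsq π (avg P f) ≤ (1 - γ) ^ 2 * nsq π f := by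
  refine hc.nsq_le_of_form_le ?_ (hc.form_le f hf) (hc.form_le _ ?_)
  · simp only [form, nsq]
    exact Finset.sum_congr rfl fun v _ => by ring
  · rw [hc.wmean_avg, hf]

lemma nsq_iterate_avg_le {f : V → ℝ} (hf : wmean π f = 0) (s : ℕ) :
    nsq π ((avg P)^[s] f) ≤ ((1 - γ) ^ s) ^ 2 * nsq π f := by
  induction s with
  | zero => simp
  | succ s ih =>
    rw [Function.iterate_succ_apply']
    refine (hc.nsq_avg_le (by rw [hc.wmean_iterate_avg, hf])).trans ?_
    calc _ ≤ (1 - γ) ^ 2 * (((1 - γ) ^ s) ^ 2 * nsq π f) :=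
          mul_le_mul_of_nonneg_left ih (sq_nonneg _)
      _ = _ := by ring

lemma wmean_sub (f : V → ℝ) : wmean π (fun v => f v - wmean π f) = 0 := by
  have : wmean π (fun v => f v - wmean π f) = wmean π f - (∑ v, π v) * wmean π f := by
    simp only [wmean, mul_sub, Finset.sum_sub_distrib, ← Finset.sum_mul]
  rw [this, hc.sum_eq_one]; ring

lemma nsq_sub_wmean (f : V → ℝ) :
    nsq π (fun v => f v - wmean π f) = nsq π f - wmean π f ^ 2 := by
  set a := wmean π f with ha
  have : nsq π (fun v => f v - a) = nsq π f - 2 * a * wmean π f + a ^ 2 * ∑ v, π v := by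
    simp only [nsq, wmean, Finset.mul_sum, ← Finset.sum_add_distrib, ← Finset.sum_sub_distrib]
    exact Finset.sum_congr rfl fun v _ => by ring
  rw [this, hc.sum_eq_one, ← ha]; ring

lemma form_sub_wmean (f : V → ℝ) :
    form π P (fun v => f v - wmean π f) (fun v => f v - wmean π f) =
      form π P f f - wmean π f ^ 2 := by
  set a := wmean π f with ha
  have : form π P (fun v => f v - a) (fun v => f v - a) =
      form π P f f - a * wmean π f - a * wmean π (avg P f) + a ^ 2 * ∑ v, π v := by
    simp only [form, avg_sub_const hc.row_sum, wmean, Finset.mul_sum, ← Finset.sum_add_distrib,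
      ← Finset.sum_sub_distrib]
    exact Finset.sum_congr rfl fun v _ => by ring
  rw [this, hc.sum_eq_one, hc.wmean_avg, ← ha]; ring

/-- Pointwise convergence to the stationary mean at a geometric rate. -/
lemma iterate_avg_le (f : V → ℝ) (s : ℕ) (x : V) :
    (avg P)^[s] f x ≤ wmean π f + √(nsq π f / π x) * (1 - γ) ^ s := by
  have h1 := hc.nsq_iterate_avg_le (hc.wmean_sub f) s
  rw [iterate_avg_sub_const hc.row_sum, hc.nsq_sub_wmean] at h1
  -- A single term of the ℓ² sum controls the value at `x`, at the price of a factor 1/√π(x).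
  have h2 := mul_sq_le_nsq hc.pos (fun v => (avg P)^[s] f v - wmean π f) x
  have hx := hc.pos x
  have hγ : 0 ≤ (1 - γ) ^ s := pow_nonneg (by linarith [hc.gap_le_one]) s
  have h3 : ((avg P)^[s] f x - wmean π f) ^ 2 ≤ nsq π f / π x * ((1 - γ) ^ s) ^ 2 := by
    rw [div_mul_eq_mul_div, le_div_iff₀ hx]
    nlinarith [sq_nonneg (wmean π f), sq_nonneg ((1 - γ) ^ s),
      mul_nonneg (sq_nonneg (wmean π f)) (sq_nonneg ((1 - γ) ^ s))]
  have h4 := Real.le_sqrt_of_sq_le h3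
  rw [Real.sqrt_mul (div_nonneg (nsq_nonneg hc.pos f) hx.le), Real.sqrt_sq hγ] at h4
  linarith

lemma pi_le_one (v : V) : π v ≤ 1 := by
  rw [← hc.sum_eq_one]
  exact Finset.single_le_sum (fun w _ => (hc.pos w).le) (Finset.mem_univ v)

/-- Centering gives ⟨f, Pf⟩ ≤ (1 - γ)‖f‖² + γm² with m the mean. Since `f` lives off `v`,
Cauchy–Schwarz there gives m² ≤ (1 - π(v))‖f‖². -/
lemma form_le_of_vanish {f : V → ℝ} {v : V} (hf : f v = 0) :
    form π P f f ≤ (1 - γ * π v) * nsq π f := by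
  have h1 := hc.form_le _ (hc.wmean_sub f)
  rw [hc.form_sub_wmean, hc.nsq_sub_wmean] at h1
  have h2 := sq_wmean_le hc.pos (Finset.univ.erase v) f
  have h3 : ∑ w ∈ Finset.univ.erase v, π w * f w = wmean π f := by
    rw [wmean, ← Finset.add_sum_erase _ _ (Finset.mem_univ v), hf]; simp
  have h4 : ∑ w ∈ Finset.univ.erase v, π w * f w ^ 2 = nsq π f := by
    rw [nsq, ← Finset.add_sum_erase _ _ (Finset.mem_univ v), hf]; simp
  have h5 : ∑ w ∈ Finset.univ.erase v, π w = 1 - π v := by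
    rw [← hc.sum_eq_one, ← Finset.add_sum_erase _ _ (Finset.mem_univ v)]; ring
  rw [h3, h4, h5] at h2
  nlinarith [hc.gap_pos]

end IsGapChain

/-- `survive P v t x` is the probability that the walk from `x` avoids `v` up to time `t`. -/
def survive (P : Matrix V V ℝ) (v : V) : ℕ → V → ℝ
  | 0 => fun x => if x = v then 0 else 1
  | t + 1 => fun x => if x = v then 0 else avg P (survive P v t) x

lemma survive_self (v : V) (t : ℕ) : survive P v t v = 0 := by
  cases t <;> simp [survive]

lemma survive_nonneg (hP : ∀ v w, 0 ≤ P v w) (v : V) (t : ℕ) (x : V) : 0 ≤ survive P v t x := by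
  induction t generalizing x with
  | zero => simp only [survive]; split_ifs <;> simp
  | succ t ih =>
    simp only [survive]
    split_ifs
    · rfl
    · exact Finset.sum_nonneg fun w _ => mul_nonneg (hP x w) (ih w)

/-- Visits to `v` during the first `s` steps are forgiven, which leaves that time for mixing. -/
lemma survive_add_le (hP : ∀ v w, 0 ≤ P v w) (v : V) (s t : ℕ) (x : V) :
    survive P v (s + t) x ≤ (avg P)^[s] (survive P v t) x := by
  induction s generalizing x with
  | zero => simp
  | succ s ih =>
    rw [Function.iterate_succ_apply', add_right_comm]
    refine le_trans ?_ (avg_mono hP ih x)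
    simp only [survive]
    split_ifs
    · exact Finset.sum_nonneg fun w _ => mul_nonneg (hP x w) (survive_nonneg hP v _ w)
    · rfl

namespace IsGapChain

variable (hc : IsGapChain P π γ)
include hc

/-- The next survival function g is Pf set to zero at `v`, where f is the current one. Hence ⟨g, Pf⟩
= ‖g‖², and since both vanish at `v`, `nsq_le_of_form_le` applies with r = 1 - γπ(v). -/
lemma nsq_survive_le (v : V) (t : ℕ) :
    nsq π (survive P v t) ≤ ((1 - γ * π v) ^ t) ^ 2 := by
  induction t with
  | zero =>
    rw [pow_zero, one_pow, ← hc.sum_eq_one, nsq]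
    refine Finset.sum_le_sum fun w _ => ?_
    simp only [survive]
    split_ifs
    · simpa using (hc.pos w).le
    · simp
  | succ t ih =>
    have h : nsq π (survive P v (t + 1)) ≤ (1 - γ * π v) ^ 2 * nsq π (survive P v t) := by
      refine hc.nsq_le_of_form_le ?_ (hc.form_le_of_vanish (survive_self v t))
        (hc.form_le_of_vanish (survive_self v (t + 1)))
      refine Finset.sum_congr rfl fun w _ => ?_
      simp only [survive]
      split_ifs
      · simp
      · ring
    calc _ ≤ (1 - γ * π v) ^ 2 * ((1 - γ * π v) ^ t) ^ 2 :=
          h.trans (mul_le_mul_of_nonneg_left ih (sq_nonneg _))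
      _ = _ := by ring

lemma gap_mul_le_one (v : V) : γ * π v ≤ 1 :=
  mul_le_one₀ hc.gap_le_one (hc.pos v).le (hc.pi_le_one v)

/-- The probability of avoiding `v` for `s + t` steps from an arbitrary start. -/
lemma survive_le (v x : V) (s t : ℕ) :
    survive P v (s + t) x ≤ (1 - γ * π v) ^ t * (1 + √(1 / π x) * (1 - γ) ^ s) := by
  have h0 : 0 ≤ (1 - γ * π v) ^ t := pow_nonneg (by linarith [hc.gap_mul_le_one v]) t
  have h1 := hc.nsq_survive_le v t
  have h2 : wmean π (survive P v t) ≤ (1 - γ * π v) ^ t := by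
    refine (abs_le_of_sq_le_sq' ?_ h0).2
    have := sq_wmean_le hc.pos Finset.univ (survive P v t)
    rw [hc.sum_eq_one, one_mul] at this
    exact le_trans this h1
  have h3 : √(nsq π (survive P v t) / π x) ≤ (1 - γ * π v) ^ t * √(1 / π x) := by
    have hx := hc.pos x
    calc _ ≤ √(((1 - γ * π v) ^ t) ^ 2 * (1 / π x)) := by
          refine Real.sqrt_le_sqrt ?_
          rw [mul_one_div]
          exact div_le_div_of_nonneg_right h1 hx.le
      _ = _ := by rw [Real.sqrt_mul (sq_nonneg _), Real.sqrt_sq h0]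
  have hγ : 0 ≤ (1 - γ) ^ s := pow_nonneg (by linarith [hc.gap_le_one]) s
  calc _ ≤ (avg P)^[s] (survive P v t) x := survive_add_le hc.nonneg v s t x
    _ ≤ _ := hc.iterate_avg_le _ s x
    _ ≤ (1 - γ * π v) ^ t + (1 - γ * π v) ^ t * √(1 / π x) * (1 - γ) ^ s :=
        add_le_add h2 (mul_le_mul_of_nonneg_right h3 hγ)
    _ = _ := by ring

end IsGapChain

end GapChain

/-! ### The lazy walk on a connected graph has a gap -/

section GraphGap

variable {V : Type*} [Fintype V] [DecidableEq V]

/-- Applied to the uniform weight on directed edges: ε = 1 yields the nonnegative form of the lazy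
walk, ε = -1 the Dirichlet energy. -/
lemma sum_sum_mul_add_sq {J : V → V → ℝ} {r : V → ℝ} (hJ : ∀ v w, J v w = J w v)
    (hr : ∀ v, ∑ w, J v w = r v) (ε : ℝ) (hε : ε ^ 2 = 1) (f : V → ℝ) :
    ∑ v, ∑ w, J v w * (f v + ε * f w) ^ 2 =
      2 * ∑ v, r v * f v ^ 2 + 2 * ε * ∑ v, ∑ w, J v w * (f v * f w) := by
  have h1 : ∑ v, ∑ w, J v w * f v ^ 2 = ∑ v, r v * f v ^ 2 := by
    simp only [← Finset.sum_mul, hr]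
  have h2 : ∑ v, ∑ w, J v w * f w ^ 2 = ∑ v, r v * f v ^ 2 := by
    rw [Finset.sum_comm, ← h1]
    simp only [hJ]
  have h3 : ∑ v, ∑ w, J v w * (f v + ε * f w) ^ 2 =
      ∑ v, ∑ w, J v w * f v ^ 2 + ε ^ 2 * ∑ v, ∑ w, J v w * f w ^ 2 +
        2 * ε * ∑ v, ∑ w, J v w * (f v * f w) := by
    simp only [Finset.mul_sum, ← Finset.sum_add_distrib]
    exact Finset.sum_congr rfl fun v _ => Finset.sum_congr rfl fun w _ => by ring
  rw [h3, h1, h2, hε]; ring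

variable {G : SimpleGraph V} [DecidableRel G.Adj]

lemma degree_pos_of_connected (hcard : 2 ≤ Fintype.card V) (hG : G.Connected) (v : V) :
    0 < G.degree v := by
  have : Nontrivial V := Fintype.one_lt_card_iff_nontrivial.1 hcard
  exact hG.preconnected.degree_pos_of_nontrivial v

lemma sum_degree_eq : ∑ v, (G.degree v : ℝ) = 2 * (G.edgeFinset.card : ℝ) := by
  exact_mod_cast G.sum_degrees_eq_twice_card_edges

lemma stationary_pos (hd : ∀ v, 0 < G.degree v) (v : V) : 0 < stationary G v := by
  have h : 0 < ∑ v, (G.degree v : ℝ) :=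
    Finset.sum_pos (fun w _ => by exact_mod_cast hd w) ⟨v, Finset.mem_univ v⟩
  have hv : (0 : ℝ) < G.degree v := by exact_mod_cast hd v
  rw [sum_degree_eq] at h
  exact div_pos hv h

lemma sum_stationary [Nonempty V] (hd : ∀ v, 0 < G.degree v) : ∑ v, stationary G v = 1 := by
  have h : 0 < ∑ v, (G.degree v : ℝ) :=
    Finset.sum_pos (fun w _ => by exact_mod_cast hd w) Finset.univ_nonempty
  simp only [stationary, ← Finset.sum_div]
  rw [← sum_degree_eq, div_self h.ne']

lemma stationary_mul_transition (hd : ∀ v, 0 < G.degree v) (v w : V) :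
    stationary G v * transition G v w = 1 / 2 * (if v = w then stationary G v else 0) +
      1 / 2 * (if G.Adj v w then 1 / (2 * (G.edgeFinset.card : ℝ)) else 0) := by
  have hv : (G.degree v : ℝ) ≠ 0 := by exact_mod_cast (hd v).ne'
  simp only [transition, (hd v).ne', if_false, stationary]
  split_ifs <;> field_simp <;> simp

lemma sum_ite_adj (v : V) :
    ∑ w, (if G.Adj v w then 1 / (2 * (G.edgeFinset.card : ℝ)) else 0) = stationary G v := by
  rw [← Finset.sum_filter, Finset.sum_const, ← SimpleGraph.neighborFinset_eq_filter,
    SimpleGraph.card_neighborFinset_eq_degree, nsmul_eq_mul, stationary, mul_one_div]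

lemma form_transition (hd : ∀ v, 0 < G.degree v) (f : V → ℝ) :
    form (stationary G) (transition G) f f = 1 / 2 * nsq (stationary G) f +
      1 / 2 * ∑ v, ∑ w, (if G.Adj v w then 1 / (2 * (G.edgeFinset.card : ℝ)) else 0) *
        (f v * f w) := by
  simp only [form, nsq, avg, Finset.mul_sum, ← Finset.sum_add_distrib]
  refine Finset.sum_congr rfl fun v _ => ?_
  have h : ∀ w, stationary G v * (f v * (transition G v w * f w)) =
      (if v = w then 1 / 2 * (stationary G v * f v ^ 2) else 0) +
      1 / 2 * ((if G.Adj v w then 1 / (2 * (G.edgeFinset.card : ℝ)) else 0) * (f v * f w)) := by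
    intro w
    calc _ = (stationary G v * transition G v w) * (f v * f w) := by ring
      _ = _ := by
        rw [stationary_mul_transition hd]
        by_cases h : v = w
        · subst h; simp; ring_nf
        · simp [h]; ring_nf
  simp only [h, Finset.sum_add_distrib, Finset.sum_ite_eq, Finset.mem_univ, if_true]

lemma form_transition_nonneg (hd : ∀ v, 0 < G.degree v) (f : V → ℝ) :
    0 ≤ form (stationary G) (transition G) f f := by
  have h := sum_sum_mul_add_sq (J := fun v w => if G.Adj v w then
    1 / (2 * (G.edgeFinset.card : ℝ)) else 0) (fun v w => by simp [G.adj_comm])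
    sum_ite_adj 1 (by norm_num) f
  have h0 : 0 ≤ ∑ v, ∑ w, (if G.Adj v w then 1 / (2 * (G.edgeFinset.card : ℝ)) else 0) *
      (f v + 1 * f w) ^ 2 :=
    Finset.sum_nonneg fun v _ => Finset.sum_nonneg fun w _ =>
      mul_nonneg (by split_ifs <;> positivity) (sq_nonneg _)
  rw [form_transition hd, nsq]
  linarith

/-- The hypothesis forces the Dirichlet energy to vanish, so `f` is constant along edges and hence
along paths. -/
lemma eq_of_nsq_le_form (hd : ∀ v, 0 < G.degree v) (hG : G.Connected) (f : V → ℝ)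
    (hf : nsq (stationary G) f ≤ form (stationary G) (transition G) f f) (v w : V) :
    f v = f w := by
  have h := sum_sum_mul_add_sq (J := fun v w => if G.Adj v w then
    1 / (2 * (G.edgeFinset.card : ℝ)) else 0) (fun v w => by simp [G.adj_comm])
    sum_ite_adj (-1) (by norm_num) f
  rw [form_transition hd, nsq] at hf
  have hn : ∀ v w, 0 ≤ (if G.Adj v w then 1 / (2 * (G.edgeFinset.card : ℝ)) else 0) *
      (f v + -1 * f w) ^ 2 := fun v w => mul_nonneg (by split_ifs <;> positivity) (sq_nonneg _)
  have h0 : ∑ v, ∑ w, (if G.Adj v w then 1 / (2 * (G.edgeFinset.card : ℝ)) else 0) *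
      (f v + -1 * f w) ^ 2 = 0 :=
    le_antisymm (by linarith)
      (Finset.sum_nonneg fun v _ => Finset.sum_nonneg fun w _ => hn v w)
  have hadj : ∀ v w, G.Adj v w → f v = f w := by
    intro v w hvw
    have h1 := (Finset.sum_eq_zero_iff_of_nonneg
      (fun v _ => Finset.sum_nonneg fun w _ => hn v w)).1 h0 v (Finset.mem_univ v)
    have h2 := (Finset.sum_eq_zero_iff_of_nonneg (fun w _ => hn v w)).1 h1 w (Finset.mem_univ w)
    have hm : (G.edgeFinset.card : ℝ) ≠ 0 := by
      have := stationary_pos hd v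
      intro h; simp [stationary, h] at this
    simp only [hvw, if_true, mul_eq_zero, one_div, inv_eq_zero] at h2
    have h3 := pow_eq_zero_iff (two_ne_zero) |>.1 (h2.resolve_left (by simpa using hm))
    linarith
  obtain ⟨p⟩ := hG.preconnected v w
  induction p with
  | nil => rfl
  | cons h _ ih => rw [hadj _ _ h, ih]

/-- The lazy walk on a connected graph is a reversible chain whose spectral gap is bounded below
by the inverse relaxation time. -/
theorem isGapChain_transition (hcard : 2 ≤ Fintype.card V) (hG : G.Connected) {C : ℝ}
    (hC : 1 ≤ C) (hrel : relaxationTime G ≤ C) :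
    IsGapChain (transition G) (stationary G) (1 / C) := by
  have hd := degree_pos_of_connected hcard hG
  have : Nonempty V := hG.nonempty
  have hpos := stationary_pos hd
  have hrev : ∀ v w, stationary G v * transition G v w =
      stationary G w * transition G w v := by
    intro v w
    rw [stationary_mul_transition hd, stationary_mul_transition hd]
    by_cases h : v = w
    · subst h; rfl
    · simp [h, Ne.symm h, G.adj_comm]
  obtain ⟨hlt, hgap⟩ := reversible_gap hpos hrev (sum_transition G)
    (fun f hf => eq_of_nsq_le_form hd hG f hf) hcard
  change lambdaTwo G < 1 at hlt
  change ∀ f : V → ℝ, wmean (stationary G) f = 0 →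
    form (stationary G) (transition G) f f ≤ lambdaTwo G * nsq (stationary G) f at hgap
  refine ⟨transition_nonneg G, sum_transition G, hpos, sum_stationary hd, hrev, by positivity,
    by rw [div_le_one (by linarith)]; exact hC, form_transition_nonneg hd, fun f hf => ?_⟩
  refine (hgap f hf).trans (mul_le_mul_of_nonneg_right ?_ (nsq_nonneg hpos f))
  -- Strictness matters: for λ₂ ≥ 1 the quotient defining the relaxation time would be zero or
  -- negative, and its upper bound would say nothing.
  have h1 : 0 < 1 - lambdaTwo G := by linarith
  rw [relaxationTime, div_le_iff₀ h1] at hrel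
  have : 1 / C ≤ 1 - lambdaTwo G := by
    rw [div_le_iff₀ (by linarith)]; linarith
  linarith

lemma stationaryMin_le (v : V) : stationaryMin G ≤ stationary G v :=
  ciInf_le (Set.finite_range _).bddBelow v

end GraphGap

/-! ### Unvisited sets along one trajectory -/

section Path

variable {V : Type*} [Fintype V] [DecidableEq V]

/-- The elements of `U` that the trajectory `X` has not visited up to time `t`. -/
def unvisited (U : Finset V) (X : ℕ → V) (t : ℕ) : Finset V :=
  U \ (Finset.range (t + 1)).image X

lemma unvisited_zero (U : Finset V) (X : ℕ → V) : unvisited U X 0 = U.erase (X 0) := by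
  simp [unvisited, Finset.sdiff_singleton_eq_erase]

lemma unvisited_succ (U : Finset V) (X : ℕ → V) (t : ℕ) :
    unvisited U X (t + 1) = (unvisited U X t).erase (X (t + 1)) := by
  ext v
  simp only [unvisited, Finset.mem_sdiff, Finset.mem_image, Finset.mem_range, Finset.mem_erase,
    Nat.lt_succ_iff (n := t + 1), Nat.le_succ_iff]
  grind

lemma mem_unvisited {U : Finset V} {X : ℕ → V} {t : ℕ} {v : V} :
    v ∈ unvisited U X t ↔ v ∈ U ∧ ∀ s ≤ t, X s ≠ v := by
  simp [unvisited]

/-- One step of the chain that records the current vertex and the unvisited part of a set, acting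
on functions. -/
def sweep (P : Matrix V V ℝ) (F : Finset V → V → ℝ) (U : Finset V) (x : V) : ℝ :=
  ∑ y, P x y * F (U.erase y) y

lemma sweep_nonneg {P : Matrix V V ℝ} (hP : ∀ v w, 0 ≤ P v w) {F : Finset V → V → ℝ}
    (hF : ∀ U x, 0 ≤ F U x) (U : Finset V) (x : V) : 0 ≤ sweep P F U x :=
  Finset.sum_nonneg fun y _ => mul_nonneg (hP x y) (hF _ y)

end Path

/-! ### Markov property and expectations over trajectories -/

section Law

variable {V : Type*} [Fintype V] [DecidableEq V] [MeasurableSpace V] [MeasurableSingletonClass V]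
  {G : SimpleGraph V} [DecidableRel G.Adj]

/-- The measure on `V` with weights `p`. -/
noncomputable def weighted (p : V → ℝ) : Measure V := ∑ v, ENNReal.ofReal (p v) • Measure.dirac v

lemma isProbabilityMeasure_weighted {p : V → ℝ} (hp : ∀ v, 0 ≤ p v) (h1 : ∑ v, p v = 1) :
    IsProbabilityMeasure (weighted p) := by
  constructor
  simp only [weighted, Measure.coe_finsetSum, Finset.sum_apply, Measure.smul_apply,
    measure_univ, smul_eq_mul, mul_one]
  rw [← ENNReal.ofReal_sum_of_nonneg fun w _ => hp w, h1, ENNReal.ofReal_one]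

lemma lintegral_weighted {p : V → ℝ} (hp : ∀ v, 0 ≤ p v) {f : V → ℝ} (hf : ∀ v, 0 ≤ f v) :
    ∫⁻ v, ENNReal.ofReal (f v) ∂weighted p = ENNReal.ofReal (∑ v, p v * f v) := by
  rw [weighted, lintegral_finsetSum_measure,
    ENNReal.ofReal_sum_of_nonneg fun w _ => mul_nonneg (hp w) (hf w)]
  refine Finset.sum_congr rfl fun v _ => ?_
  rw [lintegral_smul_measure, lintegral_dirac, ENNReal.ofReal_mul (hp v), smul_eq_mul]

lemma dirac_eq_weighted (u : V) : Measure.dirac u = weighted (Pi.single u 1) := by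
  rw [weighted, Finset.sum_eq_single u]
  · simp
  · intro v _ hv; simp [hv]
  · simp

variable (G)

lemma walkLaw_map_zero (μ : Measure V) [IsProbabilityMeasure μ] :
    (walkLaw G μ).map (fun X => X 0) = μ := by
  have h : (fun X : ℕ → V => X 0) =
      (fun h : Π _ : Finset.Iic 0, V => h ⟨0, by simp⟩) ∘ Preorder.frestrictLe 0 := rfl
  rw [h, ← Measure.map_map (by fun_prop) (by fun_prop), walkLaw, Kernel.trajMeasure,
    Measure.map_comp _ _ (by fun_prop), Kernel.traj_map_frestrictLe, Kernel.partialTraj_self,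
    Measure.id_comp, Measure.map_map (by fun_prop) (by fun_prop)]
  exact Measure.map_id

/-- The Markov property of the walk, integrated against functions of the history. -/
lemma lintegral_walkLaw_succ (μ : Measure V) [IsProbabilityMeasure μ] (t : ℕ)
    (g : (Π _ : Finset.Iic t, V) → V → ℝ≥0∞) :
    ∫⁻ X, g (Preorder.frestrictLe t X) (X (t + 1)) ∂walkLaw G μ =
      ∫⁻ X, ∫⁻ y, g (Preorder.frestrictLe t X) y ∂stepLaw G (X t) ∂walkLaw G μ := by
  have h := Kernel.map_frestrictLe_trajMeasure_compProd_eq_map_trajMeasure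
    (X := fun _ => V) (κ := stepKernel G) (μ₀ := μ) (a := t)
  have hg : Measurable (Function.uncurry g) := Measurable.of_discrete
  have h2 := lintegral_map (μ := walkLaw G μ) (f := Function.uncurry g)
    (g := fun X : ℕ → V => (Preorder.frestrictLe (π := fun _ => V) t X, X (t + 1))) hg
    (by fun_prop)
  simp only [Function.uncurry] at h2
  rw [← h2, walkLaw, ← h]
  refine (Measure.lintegral_compProd hg).trans ?_
  rw [lintegral_map Measurable.of_discrete (by fun_prop)]
  rfl

variable {G}

/-- Expectations of functions of the unvisited set and the current vertex. -/
theorem lintegral_unvisited {p : V → ℝ} (hp : ∀ v, 0 ≤ p v) (h1 : ∑ v, p v = 1) (t : ℕ)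
    (U : Finset V) {F : Finset V → V → ℝ} (hF : ∀ U x, 0 ≤ F U x) :
    ∫⁻ X, ENNReal.ofReal (F (unvisited U X t) (X t)) ∂walkLaw G (weighted p) =
      ENNReal.ofReal (∑ x, p x * (sweep (transition G))^[t] F (U.erase x) x) := by
  have := isProbabilityMeasure_weighted hp h1
  induction t generalizing F with
  | zero =>
    simp only [unvisited_zero, Function.iterate_zero, id]
    rw [← lintegral_weighted hp fun v => hF _ v]
    conv_rhs => rw [← walkLaw_map_zero G (weighted p)]
    rw [lintegral_map Measurable.of_discrete (by fun_prop)]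
  | succ t ih =>
    rw [Function.iterate_succ_apply, ← ih (sweep_nonneg (transition_nonneg G) hF)]
    -- The unvisited set depends only on the history up to `t`, so the Markov property can be
    -- applied with it held fixed.
    have hu : ∀ X : ℕ → V, unvisited U X t =
        U \ Finset.univ.image (Preorder.frestrictLe (π := fun _ => V) t X) := by
      intro X
      ext v
      simp only [mem_unvisited, Finset.mem_sdiff, Finset.mem_image, Finset.mem_univ, true_and,
        not_exists, Subtype.forall, Finset.mem_Iic, Preorder.frestrictLe_apply, ne_eq]
    have h := lintegral_walkLaw_succ G (weighted p) t
      fun h y => ENNReal.ofReal (F ((U \ Finset.univ.image h).erase y) y)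
    simp only [← hu] at h
    simp only [unvisited_succ]
    rw [h]
    refine lintegral_congr fun X => ?_
    exact lintegral_weighted (fun v => transition_nonneg G _ v) fun v => hF _ v

lemma isProbabilityMeasure_walkLaw (μ : Measure V) [IsProbabilityMeasure μ] :
    IsProbabilityMeasure (walkLaw G μ) :=
  inferInstanceAs (IsProbabilityMeasure (Kernel.trajMeasure (X := fun _ => V) μ (stepKernel G)))

/-- The law of the walk is a mixture over its starting vertex. -/
lemma walkLaw_weighted {p : V → ℝ} (f : (ℕ → V) → ℝ≥0∞) (hf : Measurable f) :
    ∫⁻ X, f X ∂walkLaw G (weighted p) =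
      ∑ v, ENNReal.ofReal (p v) * ∫⁻ X, f X ∂walkLaw G (Measure.dirac v) := by
  have h : ∀ μ : Measure V, ∫⁻ X, f X ∂walkLaw G μ = ∫⁻ v, ∫⁻ X, f X
      ∂(Kernel.traj (X := fun _ => V) (stepKernel G) 0
        ((MeasurableEquiv.piUnique (fun _ : Finset.Iic 0 => V)).symm v)) ∂μ := by
    intro μ
    rw [walkLaw, Kernel.trajMeasure, Measure.lintegral_bind (Kernel.aemeasurable _)
      hf.aemeasurable, lintegral_map]
    · exact hf.lintegral_kernel
    · fun_prop
  rw [h, weighted, lintegral_finsetSum_measure]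
  refine Finset.sum_congr rfl fun v _ => ?_
  rw [h, lintegral_smul_measure, lintegral_dirac, smul_eq_mul]

end Law

/-! ### Products of trajectory laws -/

section Pi

variable {Ω : Type*} [MeasurableSpace Ω]

lemma lintegral_pi_succ {k : ℕ} (ν : Fin (k + 1) → Measure Ω) [∀ i, IsProbabilityMeasure (ν i)]
    {f : (Fin (k + 1) → Ω) → ℝ≥0∞} (hf : Measurable f) :
    ∫⁻ X, f X ∂Measure.pi ν =
      ∫⁻ x, ∫⁻ Y, f (Fin.cons x Y) ∂Measure.pi (fun i : Fin k => ν i.succ) ∂ν 0 := by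
  have h := (measurePreserving_piFinSuccAbove ν 0).symm
  rw [← h.lintegral_comp hf, lintegral_prod _ (by fun_prop)]
  simp [MeasurableEquiv.piFinSuccAbove_symm_apply, Fin.insertNthEquiv]

lemma measurable_cons {k : ℕ} :
    Measurable fun z : Ω × (Fin k → Ω) => (Fin.cons z.1 z.2 : Fin (k + 1) → Ω) := by
  refine measurable_pi_lambda _ fun i => ?_
  refine Fin.cases ?_ (fun j => ?_) i
  · simpa using measurable_fst
  · simpa [Function.comp_def] using (measurable_pi_apply j).comp measurable_snd

lemma lintegral_pi_succ_swap {k : ℕ} (ν : Fin (k + 1) → Measure Ω)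
    [∀ i, IsProbabilityMeasure (ν i)] {f : (Fin (k + 1) → Ω) → ℝ≥0∞} (hf : Measurable f) :
    ∫⁻ X, f X ∂Measure.pi ν =
      ∫⁻ Y, ∫⁻ x, f (Fin.cons x Y) ∂ν 0 ∂Measure.pi (fun i : Fin k => ν i.succ) := by
  rw [lintegral_pi_succ ν hf, lintegral_lintegral_swap]
  exact (hf.comp measurable_cons).aemeasurable

/-- An integral against a power of a mixture is at most the largest integral against a product of
components. -/
lemma lintegral_pi_mixture_le {ι : Type*} [Fintype ι] {w : ι → ℝ≥0∞} (hw : ∑ v, w v = 1)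
    {ν : Measure Ω} [IsProbabilityMeasure ν] {κ : ι → Measure Ω}
    [∀ v, IsProbabilityMeasure (κ v)]
    (hν : ∀ f : Ω → ℝ≥0∞, Measurable f → ∫⁻ x, f x ∂ν = ∑ v, w v * ∫⁻ x, f x ∂κ v) (k : ℕ)
    {f : (Fin k → Ω) → ℝ≥0∞} (hf : Measurable f) :
    ∫⁻ X, f X ∂Measure.pi (fun _ : Fin k => ν) ≤
      ⨆ u : Fin k → ι, ∫⁻ X, f X ∂Measure.pi (fun i => κ (u i)) := by
  induction k with
  | zero =>
    refine le_trans (le_of_eq ?_) (le_iSup _ (Fin.elim0 : Fin 0 → ι))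
    congr 2
    exact funext fun i => i.elim0
  | succ k ih =>
    have hfm := hf.comp (measurable_cons (Ω := Ω) (k := k))
    rw [lintegral_pi_succ _ hf]
    refine (hν _ hfm.lintegral_prod_right').trans_le ?_
    calc _ ≤ ∑ v, w v * ⨆ u : Fin (k + 1) → ι, ∫⁻ X, f X ∂Measure.pi (fun i => κ (u i)) := by
          refine Finset.sum_le_sum fun v _ => mul_le_mul_right ?_ _
          -- With the first component fixed as `v`, its variable is integrated innermost, which
          -- leaves a function of `k` variables for the induction hypothesis.
          rw [lintegral_lintegral_swap (f := fun x Y => (f ∘ fun z : Ω × (Fin k → Ω) =>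
            (Fin.cons z.1 z.2 : Fin (k + 1) → Ω)) (x, Y)) hfm.aemeasurable]
          refine (ih hfm.lintegral_prod_left').trans (iSup_le fun u => ?_)
          refine le_trans (le_of_eq ?_) (le_iSup _ (Fin.cons v u : Fin (k + 1) → ι))
          rw [lintegral_pi_succ_swap _ hf]
          simp
      _ = _ := by rw [← Finset.sum_mul, hw, one_mul]

end Pi

/-! ### Cover times and the event of not being covered -/

section Cover

variable {V : Type*} [Fintype V] [DecidableEq V] [MeasurableSpace V] [MeasurableSingletonClass V]

/-- The event that some vertex is not visited by any of the trajectories up to time `t`. -/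
def uncovered (V : Type*) (k t : ℕ) : Set (Fin k → ℕ → V) :=
  ⋃ v : V, Set.univ.pi fun _ => {X | ∀ s ≤ t, X s ≠ v}

lemma measurableSet_avoid (v : V) (t : ℕ) : MeasurableSet {X : ℕ → V | ∀ s ≤ t, X s ≠ v} := by
  have h : {X : ℕ → V | ∀ s ≤ t, X s ≠ v} = ⋂ s ∈ Set.Iic t, (fun X => X s) ⁻¹' {v}ᶜ := by
    ext X; simp
  rw [h]
  exact MeasurableSet.biInter (Set.to_countable _) fun s _ =>
    measurable_pi_apply s (measurableSet_singleton v).compl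

lemma measurableSet_uncovered (k t : ℕ) : MeasurableSet (uncovered V k t) :=
  MeasurableSet.iUnion fun v => MeasurableSet.univ_pi fun _ => measurableSet_avoid v t

lemma mem_uncovered {k t : ℕ} {X : Fin k → ℕ → V} :
    X ∈ uncovered V k t ↔ ¬ ∀ v : V, ∃ i : Fin k, ∃ s ≤ t, X i s = v := by
  simp [uncovered]

/-- Each time before the first covering time contributes one to the sum; if covering never happens,
the sum is infinite. -/
lemma coverTime_le_tsum {k : ℕ} (X : Fin k → ℕ → V) :
    coverTime X ≤ ∑' t, (uncovered V k t).indicator 1 X := by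
  by_cases h : ∃ t, X ∉ uncovered V k t
  · classical
    have h1 : coverTime X ≤ (Nat.find h : ℝ≥0∞) :=
      iInf₂_le (Nat.find h) (by simpa only [mem_uncovered, not_not] using Nat.find_spec h)
    have h2 : (Nat.find h : ℝ≥0∞) =
        ∑ t ∈ Finset.range (Nat.find h), (uncovered V k t).indicator 1 X := by
      rw [Finset.sum_congr rfl (g := fun _ => (1 : ℝ≥0∞))]
      · simp
      · intro t ht
        have := Nat.find_min h (Finset.mem_range.1 ht)
        rw [not_not] at this
        simp [this]
    rw [h2] at h1
    exact h1.trans (ENNReal.sum_le_tsum _)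
  · push Not at h
    simp [h]

/-- The gain of one over `t` makes the bound nontrivial already at t = 0, as small graphs require.
-/
lemma le_coverTime {k t : ℕ} {X : Fin k → ℕ → V} (hX : X ∈ uncovered V k t) :
    ((t + 1 : ℕ) : ℝ≥0∞) ≤ coverTime X := by
  refine le_iInf₂ fun s hs => ?_
  have h : t < s := by
    by_contra hst
    refine mem_uncovered.1 hX fun v => ?_
    obtain ⟨i, r, hr, h⟩ := hs v
    exact ⟨i, r, by omega, h⟩
  exact_mod_cast h

variable {G : SimpleGraph V} [DecidableRel G.Adj]

lemma expectedCoverTime_le_tsum {k : ℕ} (μ : Fin k → Measure V) :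
    expectedCoverTime G μ ≤ ∑' t, (Measure.pi fun i => walkLaw G (μ i)) (uncovered V k t) := by
  refine (lintegral_mono fun X => coverTime_le_tsum X).trans (le_of_eq ?_)
  rw [lintegral_tsum fun t => (measurable_one.indicator (measurableSet_uncovered k t)).aemeasurable]
  exact tsum_congr fun t => lintegral_indicator_one (measurableSet_uncovered k t)

lemma le_expectedCoverTime {k : ℕ} (μ : Fin k → Measure V) (t : ℕ) :
    ((t + 1 : ℕ) : ℝ≥0∞) * (Measure.pi fun i => walkLaw G (μ i)) (uncovered V k t) ≤
      expectedCoverTime G μ := by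
  rw [← lintegral_indicator_one (measurableSet_uncovered k t),
    ← lintegral_const_mul _ (measurable_one.indicator (measurableSet_uncovered k t))]
  refine lintegral_mono fun X => ?_
  by_cases hX : X ∈ uncovered V k t
  · simpa [hX] using le_coverTime hX
  · simp [hX]

/-- Membership of `v` ends exactly when the walk hits `v`, so the sweep reduces to the chain killed
there. Erasing `x` accounts for the visit at time 0. -/
lemma iterate_sweep_mem (P : Matrix V V ℝ) (v : V) (t : ℕ) (U : Finset V) (x : V) :
    (sweep P)^[t] (fun U _ => if v ∈ U then 1 else 0) (U.erase x) x =
      if v ∈ U then survive P v t x else 0 := by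
  induction t generalizing U x with
  | zero =>
    simp only [Function.iterate_zero, id, Finset.mem_erase, survive]
    grind
  | succ t ih =>
    rw [Function.iterate_succ_apply']
    simp only [sweep, ih, Finset.mem_erase, survive, avg]
    rcases eq_or_ne x v with rfl | h2
    · simp
    · by_cases h1 : v ∈ U <;> simp [h1, h2, h2.symm]

lemma walkLaw_avoid {p : V → ℝ} (hp : ∀ v, 0 ≤ p v) (h1 : ∑ v, p v = 1) (v : V) (t : ℕ) :
    walkLaw G (weighted p) {X | ∀ s ≤ t, X s ≠ v} =
      ENNReal.ofReal (∑ x, p x * survive (transition G) v t x) := by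
  have h := lintegral_unvisited (G := G) hp h1 t {v} (F := fun U _ => if v ∈ U then 1 else 0)
    (fun U x => by split_ifs <;> simp)
  simp only [iterate_sweep_mem, Finset.mem_singleton, if_true] at h
  rw [← h, ← lintegral_indicator_one (measurableSet_avoid v t)]
  refine lintegral_congr fun X => ?_
  simp only [mem_unvisited, Finset.mem_singleton, true_and, Set.indicator_apply,
    Set.mem_ofPred_eq, Pi.one_apply]
  split_ifs <;> simp

/-- A union bound for the probability that some vertex is missed, uniform in the starts. -/
lemma measure_uncovered_le {k : ℕ} {p : Fin k → V → ℝ} (hp : ∀ i v, 0 ≤ p i v)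
    (h1 : ∀ i, ∑ v, p i v = 1) {t : ℕ} {q : ℝ} (hq0 : 0 ≤ q)
    (hq : ∀ v x, survive (transition G) v t x ≤ q) :
    (Measure.pi fun i => walkLaw G (weighted (p i))) (uncovered V k t) ≤
      ENNReal.ofReal (Fintype.card V * q ^ k) := by
  have := fun i => isProbabilityMeasure_weighted (hp i) (h1 i)
  have := fun i => isProbabilityMeasure_walkLaw (G := G) (weighted (p i))
  refine (measure_iUnion_fintype_le _ _).trans ?_
  calc _ ≤ ∑ v : V, ENNReal.ofReal (q ^ k) := by
        refine Finset.sum_le_sum fun v _ => ?_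
        rw [Measure.pi_pi, ENNReal.ofReal_pow hq0]
        calc _ ≤ ∏ i : Fin k, ENNReal.ofReal q := by
              refine Finset.prod_le_prod' fun i _ => ?_
              rw [walkLaw_avoid (hp i) (h1 i)]
              refine ENNReal.ofReal_le_ofReal ?_
              calc _ ≤ ∑ x, p i x * q :=
                    Finset.sum_le_sum fun x _ => mul_le_mul_of_nonneg_left (hq v x) (hp i x)
                _ = q := by rw [← Finset.sum_mul, h1, one_mul]
          _ = _ := by simp
    _ = _ := by
        rw [Finset.sum_const, Finset.card_univ, nsmul_eq_mul,
          ENNReal.ofReal_mul (Nat.cast_nonneg _), ENNReal.ofReal_natCast]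

end Cover

/-! ### Upper bound from a geometric tail -/

section Upper

lemma one_div_one_sub_le {y θ : ℝ} (hy : 0 < y) (hθ : θ ≤ Real.exp (-y)) :
    1 / (1 - θ) ≤ 1 + 1 / y := by
  have h1 : Real.exp (-y) ≤ 1 / (1 + y) := by
    rw [Real.exp_neg, ← one_div]
    exact one_div_le_one_div_of_le (by linarith) (by linarith [Real.add_one_le_exp y])
  have h2 : y / (1 + y) ≤ 1 - θ := by
    have : y / (1 + y) = 1 - 1 / (1 + y) := by field_simp; ring
    linarith
  have h3 : 0 < y / (1 + y) := by positivity
  calc 1 / (1 - θ) ≤ 1 / (y / (1 + y)) := one_div_le_one_div_of_le h3 h2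
    _ = _ := by field_simp; ring

lemma tsum_le_of_geometric_tail {a : ℕ → ℝ≥0∞} (ha : ∀ t, a t ≤ 1) (N : ℕ) {A θ : ℝ}
    (hA : 0 ≤ A) (hθ0 : 0 ≤ θ) (hθ1 : θ < 1)
    (h : ∀ j, a (N + j) ≤ ENNReal.ofReal (A * θ ^ j)) :
    ∑' t, a t ≤ ENNReal.ofReal (N + A * (1 / (1 - θ))) := by
  have h0 : 0 ≤ 1 / (1 - θ) := by
    have : 0 < 1 - θ := by linarith
    positivity
  rw [← ENNReal.summable.sum_add_tsum_nat_add' (k := N),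
    ENNReal.ofReal_add (Nat.cast_nonneg N) (mul_nonneg hA h0)]
  refine add_le_add ?_ ?_
  · calc _ ≤ ∑ t ∈ Finset.range N, (1 : ℝ≥0∞) := Finset.sum_le_sum fun t _ => ha t
      _ = _ := by simp
  · have hs := (hasSum_geometric_of_lt_one hθ0 hθ1).mul_left A
    rw [one_div, ← hs.tsum_eq, ENNReal.ofReal_tsum_of_nonneg
      (fun j => mul_nonneg hA (pow_nonneg hθ0 j)) hs.summable]
    exact ENNReal.tsum_le_tsum fun j => by rw [add_comm]; exact h j

variable {V : Type*} [Fintype V] [DecidableEq V] [MeasurableSpace V] [MeasurableSingletonClass V]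
  {G : SimpleGraph V} [DecidableRel G.Adj]

/-- Fixes the burn-in time. The target is 1/n because 1 plus the error is later raised to a power k
≤ n. The square root is bounded crudely by n/c, which costs only a constant factor in time. -/
lemma sqrt_mul_pow_ceil_le {n c γ : ℝ} (hn : 1 ≤ n) (hc0 : 0 < c) (hc1 : c ≤ 1) (hγ0 : 0 < γ)
    (hγ1 : γ ≤ 1) : √(n / c) * (1 - γ) ^ ⌈Real.log (n ^ 2 / c) / γ⌉₊ ≤ 1 / n := by
  have h1 : 1 ≤ n / c := by rw [le_div_iff₀ hc0]; linarith
  have h2 : √(n / c) ≤ n / c := Real.sqrt_le_iff.2 ⟨by linarith, by nlinarith⟩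
  have h3 : (1 - γ) ^ ⌈Real.log (n ^ 2 / c) / γ⌉₊ ≤ c / n ^ 2 := by
    have hpos : 0 < n ^ 2 / c := by positivity
    calc (1 - γ) ^ ⌈Real.log (n ^ 2 / c) / γ⌉₊
        ≤ Real.exp (-γ) ^ ⌈Real.log (n ^ 2 / c) / γ⌉₊ :=
          pow_le_pow_left₀ (by linarith) (Real.one_sub_le_exp_neg γ) _
      _ = Real.exp (⌈Real.log (n ^ 2 / c) / γ⌉₊ * -γ) := (Real.exp_nat_mul _ _).symm
      _ ≤ Real.exp (-Real.log (n ^ 2 / c)) := by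
          refine Real.exp_le_exp.2 ?_
          have := Nat.le_ceil (Real.log (n ^ 2 / c) / γ)
          rw [div_le_iff₀ hγ0] at this
          linarith
      _ = c / n ^ 2 := by rw [Real.exp_neg, Real.exp_log hpos, inv_div]
  calc _ ≤ n / c * (c / n ^ 2) :=
        mul_le_mul h2 h3 (pow_nonneg (by linarith) _) (by positivity)
    _ = 1 / n := by field_simp

lemma one_add_one_div_pow_le {n k : ℕ} (hn : 0 < n) (hk : k ≤ n) :
    (1 + 1 / (n : ℝ)) ^ k ≤ 3 := by
  have hn' : (0 : ℝ) < n := by exact_mod_cast hn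
  have hk' : (k : ℝ) ≤ n := by exact_mod_cast hk
  calc (1 + 1 / (n : ℝ)) ^ k ≤ Real.exp (1 / n) ^ k :=
        pow_le_pow_left₀ (by positivity) (by linarith [Real.add_one_le_exp (1 / (n : ℝ))]) _
    _ = Real.exp (k * (1 / n)) := (Real.exp_nat_mul _ _).symm
    _ ≤ Real.exp 1 := Real.exp_le_exp.2 (by rw [mul_one_div, div_le_one hn']; exact hk')
    _ ≤ 3 := by linarith [Real.exp_one_lt_d9]

/-- The upper bound on the cover time, uniform in the initial distributions. -/
theorem expectedCoverTime_le {γ c : ℝ} (hP : IsGapChain (transition G) (stationary G) γ)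
    (hc0 : 0 < c) (hc1 : c ≤ 1) (hcard : 2 ≤ Fintype.card V)
    (hmin : ∀ v, c / Fintype.card V ≤ stationary G v) {k : ℕ} (hk1 : 1 ≤ k)
    (hkn : k ≤ Fintype.card V) {p : Fin k → V → ℝ} (hp : ∀ i v, 0 ≤ p i v)
    (h1 : ∀ i, ∑ v, p i v = 1) :
    expectedCoverTime G (fun i => weighted (p i)) ≤
      ENNReal.ofReal (((2 + 2 * Real.log (1 / c)) / γ + 10 + 7 / (γ * c)) *
        ((Fintype.card V : ℝ) / k * Real.log (Fintype.card V))) := by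
  set n := Fintype.card V with hn
  have hn2 : (2 : ℝ) ≤ n := by exact_mod_cast hcard
  have hn0 : (0 : ℝ) < n := by linarith
  have hk0 : (1 : ℝ) ≤ k := by exact_mod_cast hk1
  have hkn' : (k : ℝ) ≤ n := by exact_mod_cast hkn
  have hγ0 := hP.gap_pos
  have hγ1 := hP.gap_le_one
  -- A lower bound for the rate at which the k walks together find a given vertex: `θ` below is at
  -- most exp(-y).
  set y := γ * c * k / n with hy
  have hy0 : 0 < y := by positivity
  set T := ⌈Real.log ((n : ℝ) ^ 2 / c) / γ⌉₊ with hT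
  -- By this time the exponential decay compensates the `n` terms of the union bound.
  set t0 := ⌈Real.log n / y⌉₊ with ht0
  set r := 1 - γ * c / n with hr
  have hr0 : 0 ≤ r := by
    have : γ * c / n ≤ 1 := by rw [div_le_one hn0]; nlinarith
    linarith
  set θ := r ^ k with hθ
  have hθ0 : 0 ≤ θ := pow_nonneg hr0 k
  have hθe : θ ≤ Real.exp (-y) := by
    calc θ ≤ Real.exp (-(γ * c / n)) ^ k :=
          pow_le_pow_left₀ hr0 (Real.one_sub_le_exp_neg _) k
      _ = Real.exp (-y) := by rw [← Real.exp_nat_mul, hy]; congr 1; ring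
  have hθ1 : θ < 1 := hθe.trans_lt (by rw [Real.exp_lt_one_iff]; linarith)
  have hsurv : ∀ t v x, survive (transition G) v (T + t) x ≤ r ^ t * (1 + 1 / n) := by
    intro t v x
    refine (hP.survive_le v x T t).trans ?_
    have hv := hmin v
    have hx := hmin x
    have h2 : (1 - γ * stationary G v) ^ t ≤ r ^ t := by
      refine pow_le_pow_left₀ (by linarith [hP.gap_mul_le_one v]) ?_ t
      have : γ * (c / n) ≤ γ * stationary G v := mul_le_mul_of_nonneg_left hv hγ0.le
      rw [← mul_div_assoc] at this
      linarith
    have h3 : √(1 / stationary G x) ≤ √(n / c) := by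
      refine Real.sqrt_le_sqrt ?_
      rw [← one_div_div c]
      exact one_div_le_one_div_of_le (by positivity) hx
    have h4 : √(1 / stationary G x) * (1 - γ) ^ T ≤ 1 / n :=
      (mul_le_mul_of_nonneg_right h3 (pow_nonneg (by linarith) T)).trans
        (sqrt_mul_pow_ceil_le (by linarith) hc0 hc1 hγ0 hγ1)
    refine mul_le_mul h2 (by linarith) ?_ (pow_nonneg hr0 t)
    have := mul_nonneg (Real.sqrt_nonneg (1 / stationary G x))
      (pow_nonneg (by linarith : (0 : ℝ) ≤ 1 - γ) T)
    linarith
  have hnθ : n * θ ^ t0 ≤ 1 := by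
    calc n * θ ^ t0 ≤ n * Real.exp (-y) ^ t0 :=
          mul_le_mul_of_nonneg_left (pow_le_pow_left₀ hθ0 hθe t0) hn0.le
      _ = n * Real.exp (t0 * -y) := by rw [← Real.exp_nat_mul]
      _ ≤ n * Real.exp (-Real.log n) := by
          refine mul_le_mul_of_nonneg_left (Real.exp_le_exp.2 ?_) hn0.le
          have := Nat.le_ceil (Real.log n / y)
          rw [div_le_iff₀ hy0] at this
          linarith
      _ = 1 := by rw [Real.exp_neg, Real.exp_log hn0, mul_inv_cancel₀ hn0.ne']
  have hprob := fun i => isProbabilityMeasure_weighted (hp i) (h1 i)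
  have hprob' := fun i => isProbabilityMeasure_walkLaw (G := G) (weighted (p i))
  refine (expectedCoverTime_le_tsum _).trans ?_
  refine (tsum_le_of_geometric_tail (fun t => prob_le_one) (T + t0) (A := 3) (by norm_num) hθ0 hθ1
    fun j => ?_).trans (ENNReal.ofReal_le_ofReal ?_)
  · have hq0 : 0 ≤ r ^ (t0 + j) * (1 + 1 / n) := mul_nonneg (pow_nonneg hr0 _) (by positivity)
    rw [add_assoc]
    refine (measure_uncovered_le hp h1 hq0 (hsurv (t0 + j))).trans (ENNReal.ofReal_le_ofReal ?_)
    calc (n : ℝ) * (r ^ (t0 + j) * (1 + 1 / n)) ^ k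
        = (n * θ ^ t0) * θ ^ j * (1 + 1 / n) ^ k := by
          rw [hθ, mul_pow, pow_add, mul_pow, pow_right_comm r t0, pow_right_comm r j]; ring
      _ ≤ 1 * θ ^ j * 3 := by
          refine mul_le_mul (mul_le_mul_of_nonneg_right hnθ (pow_nonneg hθ0 j))
            (one_add_one_div_pow_le (by omega) hkn) (by positivity) ?_
          rw [one_mul]; exact pow_nonneg hθ0 j
      _ = 3 * θ ^ j := by ring
  -- Every term is compared with R = (n/k) log n: k ≤ n absorbs the burn-in, and log n ≥ log 2 ≥ 1/2
  -- absorbs the constants and the multiples of n/k.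
  · have hlog : 1 / 2 ≤ Real.log n :=
      (by linarith [Real.log_two_gt_d9] : (1 : ℝ) / 2 ≤ Real.log 2).trans
        (Real.log_le_log (by norm_num) hn2)
    have hnk : 1 ≤ (n : ℝ) / k := by rw [le_div_iff₀ (by linarith)]; linarith
    set R := (n : ℝ) / k * Real.log n with hR
    have hR1 : Real.log n ≤ R := by nlinarith
    have hR2 : (n : ℝ) / k ≤ 2 * R := by nlinarith
    have hL : 0 ≤ Real.log (1 / c) :=
      Real.log_nonneg (by rw [le_div_iff₀ hc0]; linarith)
    have hTle : (T : ℝ) ≤ (2 * R + 2 * R * Real.log (1 / c)) / γ + 2 * R := by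
      have h5 : 0 ≤ Real.log ((n : ℝ) ^ 2 / c) / γ := by
        refine div_nonneg (Real.log_nonneg ?_) hγ0.le
        rw [le_div_iff₀ hc0]; nlinarith
      have h6 := (Nat.ceil_lt_add_one h5).le
      have h7 : Real.log ((n : ℝ) ^ 2 / c) ≤ 2 * R + 2 * R * Real.log (1 / c) := by
        rw [div_eq_mul_one_div, Real.log_mul (by positivity) (by positivity), Real.log_pow]
        push_cast
        nlinarith
      have h8 := div_le_div_of_nonneg_right h7 hγ0.le
      linarith
    have h1y : 1 / y = (n / k) * (1 / (γ * c)) := by rw [hy]; field_simp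
    have hgc : 0 < 1 / (γ * c) := by positivity
    have ht0le : (t0 : ℝ) ≤ R * (1 / (γ * c)) + 2 * R := by
      have h5 : 0 ≤ Real.log n / y := by positivity
      have h6 := (Nat.ceil_lt_add_one h5).le
      have h7 : Real.log n / y = R * (1 / (γ * c)) := by
        rw [div_eq_mul_one_div, h1y, hR]; ring
      linarith
    have hθle := one_div_one_sub_le hy0 hθe
    have h9 : 1 / y ≤ 2 * R * (1 / (γ * c)) := by
      rw [h1y]; exact mul_le_mul_of_nonneg_right hR2 hgc.le
    push_cast
    calc (T : ℝ) + t0 + 3 * (1 / (1 - θ))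
        ≤ ((2 * R + 2 * R * Real.log (1 / c)) / γ + 2 * R) + (R * (1 / (γ * c)) + 2 * R) +
          3 * (2 * R + 2 * R * (1 / (γ * c))) := by linarith
      _ = _ := by field_simp; ring

end Upper

/-! ### Growth of the truncated reciprocal along one walk -/

section Potential

variable {V : Type*} [Fintype V] [DecidableEq V]

/-- The reciprocal of the cardinality, truncated at `h`. -/
noncomputable def recip (h : ℝ) (U : Finset V) : ℝ := 1 / max (U.card : ℝ) h

lemma max_card_pos {h : ℝ} (hh : 0 < h) (U : Finset V) : 0 < max (U.card : ℝ) h :=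
  lt_max_of_lt_right hh

lemma recip_pos {h : ℝ} (hh : 0 < h) (U : Finset V) : 0 < recip h U :=
  one_div_pos.2 (max_card_pos hh U)

/-- Losing at most L ≤ h points at most halves the truncated size, so 1/y - 1/x = (x - y)/(xy) ≤ 2(x
- y)/x². This bound is affine in the loss, so only the expected loss matters. -/
lemma recip_le {h : ℝ} (hh : 0 < h) {U U' : Finset V} (hU : U' ⊆ U) {L : ℕ}
    (hL : U.card ≤ U'.card + L) (hLh : (L : ℝ) ≤ h) :
    recip h U' ≤ recip h U + 2 * recip h U / max (U.card : ℝ) h * (U.card - U'.card) := by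
  set x := max (U.card : ℝ) h with hx
  set y := max (U'.card : ℝ) h with hy
  have hx0 : 0 < x := max_card_pos hh U
  have hy0 : 0 < y := max_card_pos hh U'
  have hcard : (U'.card : ℝ) ≤ U.card := by exact_mod_cast Finset.card_le_card hU
  have hL' : (U.card : ℝ) ≤ U'.card + L := by exact_mod_cast hL
  have hxy : x - y ≤ U.card - U'.card := by
    rcases max_cases (U.card : ℝ) h with h1 | h1
    · linarith [le_max_left (U'.card : ℝ) h]
    · linarith [le_max_right (U'.card : ℝ) h]
  have hyx : y ≤ x := max_le_max hcard le_rfl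
  have hx2 : x ≤ 2 * y := by
    rcases max_cases (U.card : ℝ) h with h1 | h1
    · linarith [le_max_left (U'.card : ℝ) h, le_max_right (U'.card : ℝ) h]
    · linarith [le_max_right (U'.card : ℝ) h]
  have key : x * x ≤ y * (x + 2 * (U.card - U'.card)) := by nlinarith
  have h2 : recip h U + 2 * recip h U / x * (U.card - U'.card) =
      (x + 2 * (U.card - U'.card)) / (x * x) := by
    rw [recip, ← hx]; field_simp
  rw [h2, recip, ← hy, div_le_div_iff₀ hy0 (mul_pos hx0 hx0)]
  linarith

variable {P : Matrix V V ℝ} {π : V → ℝ} {γ : ℝ}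

/-- Each step removes at most one point, so the comparison is needed only on subsets missing at most
`t` points; this matches the hypotheses of `recip_le`. -/
lemma iterate_sweep_le (hP : ∀ v w, 0 ≤ P v w) {F F' : Finset V → V → ℝ} (t : ℕ) (U : Finset V)
    (h : ∀ U' y, U' ⊆ U → U.card ≤ U'.card + t → F U' y ≤ F' U' y) (x : V) :
    (sweep P)^[t] F U x ≤ (sweep P)^[t] F' U x := by
  induction t generalizing U x with
  | zero => exact h U x subset_rfl (by simp)
  | succ t ih =>
    rw [Function.iterate_succ_apply', Function.iterate_succ_apply']
    refine Finset.sum_le_sum fun y _ => mul_le_mul_of_nonneg_left (ih (U.erase y) ?_ y) (hP x y)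
    intro U' z hU' hcard
    have := Finset.pred_card_le_card_erase (s := U) (a := y)
    exact h U' z (hU'.trans (Finset.erase_subset _ _)) (by omega)

lemma iterate_sweep_affine (hrow : ∀ v, ∑ w, P v w = 1) (a b : ℝ) (F : Finset V → V → ℝ) (t : ℕ)
    (U : Finset V) (x : V) :
    (sweep P)^[t] (fun U x => a + b * F U x) U x = a + b * (sweep P)^[t] F U x := by
  induction t generalizing U x with
  | zero => rfl
  | succ t ih =>
    rw [Function.iterate_succ_apply', Function.iterate_succ_apply']
    simp only [sweep, ih, mul_add, Finset.sum_add_distrib, ← Finset.sum_mul, hrow, Finset.mul_sum,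
      one_mul]
    congr 1
    exact Finset.sum_congr rfl fun y _ => by ring

/-- The indicator function of a finite set of vertices. -/
def ind (U : Finset V) (v : V) : ℝ := if v ∈ U then 1 else 0

lemma wmean_ind (U : Finset V) : wmean π (ind U) = ∑ v ∈ U, π v := by
  simp [wmean, ind, Finset.sum_ite_mem]

lemma nsq_ind (U : Finset V) : nsq π (ind U) = ∑ v ∈ U, π v := by
  simp [nsq, ind, Finset.sum_ite_mem]

lemma card_sub_ind_le {U U₀ : Finset V} (hU : U ⊆ U₀) (y : V) :
    (U.card : ℝ) - ind U₀ y ≤ (U.erase y).card := by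
  rw [ind]
  by_cases hy : y ∈ U
  · have h := Finset.card_erase_add_one hy
    have h' : ((U.erase y).card : ℝ) + 1 = U.card := by exact_mod_cast h
    rw [if_pos (hU hy)]; linarith
  · rw [Finset.erase_eq_of_notMem hy]
    split_ifs <;> simp

/-- The expected number of newly visited vertices is at most the expected number of visits. -/
lemma iterate_sweep_deficit_le (hP : ∀ v w, 0 ≤ P v w) (hrow : ∀ v, ∑ w, P v w = 1)
    {U U₀ : Finset V} (hU : U ⊆ U₀) (t : ℕ) (x : V) :
    (sweep P)^[t] (fun U' _ => (U₀.card : ℝ) - U'.card) U x ≤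
      U₀.card - U.card + ∑ s ∈ Finset.range t, (avg P)^[s + 1] (ind U₀) x := by
  induction t generalizing U x with
  | zero => simp
  | succ t ih =>
    rw [Function.iterate_succ_apply']
    calc _ ≤ ∑ y, P x y * (U₀.card - U.card + ind U₀ y +
            ∑ s ∈ Finset.range t, (avg P)^[s + 1] (ind U₀) y) := by
          refine Finset.sum_le_sum fun y _ => mul_le_mul_of_nonneg_left ?_ (hP x y)
          refine (ih ((Finset.erase_subset y U).trans hU) y).trans ?_
          linarith [card_sub_ind_le hU y]
      _ = U₀.card - U.card + avg P (ind U₀) x +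
            ∑ s ∈ Finset.range t, avg P ((avg P)^[s + 1] (ind U₀)) x := by
          simp only [mul_add, Finset.sum_add_distrib, ← Finset.sum_mul, hrow, one_mul,
            Finset.mul_sum]
          rw [Finset.sum_comm]
          rfl
      _ = _ := by
          rw [Finset.sum_range_succ']
          simp only [← Function.iterate_succ_apply' (avg P)]
          simp only [zero_add, Function.iterate_one]
          ring

/-- The purpose of the truncation: the mixing error √|U| stays relatively small even when |U| is
small. -/
lemma sqrt_div_max_le {a h : ℝ} (hh : 0 < h) : √a / max a h ≤ 1 / √h := by
  have hm : 0 < max a h := lt_max_of_lt_right hh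
  rw [div_le_div_iff₀ hm (Real.sqrt_pos.2 hh), one_mul]
  calc √a * √h ≤ √(max a h) * √(max a h) :=
        mul_le_mul (Real.sqrt_le_sqrt (le_max_left _ _)) (Real.sqrt_le_sqrt (le_max_right _ _))
          (Real.sqrt_nonneg _) (Real.sqrt_nonneg _)
    _ = max a h := Real.mul_self_sqrt hm.le

lemma sum_le_two_mul_card_div {n : ℝ} {U : Finset V} (hU : ∀ v ∈ U, π v ≤ 2 / n) :
    ∑ v ∈ U, π v ≤ 2 * U.card / n := by
  refine (Finset.sum_le_sum hU).trans (le_of_eq ?_)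
  rw [Finset.sum_const, nsmul_eq_mul]; ring

lemma recip_affine_le {h n : ℝ} (hh : 0 < h) (hn : 0 < n) {U : Finset V} {L K : ℝ} (hL : 0 ≤ L)
    (hK : 0 ≤ K) :
    recip h U + 2 * recip h U / max (U.card : ℝ) h * (L * (2 * U.card / n) + K * √U.card) ≤
      recip h U * (1 + 4 * L / n + 2 * K / √h) := by
  have hm := max_card_pos hh U
  have h1 : (U.card : ℝ) / max (U.card : ℝ) h ≤ 1 := by
    rw [div_le_one hm]; exact le_max_left _ _
  have h2 := sqrt_div_max_le (a := U.card) hh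
  have h3 : 4 * L / n * ((U.card : ℝ) / max (U.card : ℝ) h) ≤ 4 * L / n * 1 :=
    mul_le_mul_of_nonneg_left h1 (by positivity)
  have h4 : 2 * K * (√(U.card : ℝ) / max (U.card : ℝ) h) ≤ 2 * K * (1 / √h) :=
    mul_le_mul_of_nonneg_left h2 (by positivity)
  calc _ = recip h U * (1 + 4 * L / n * ((U.card : ℝ) / max (U.card : ℝ) h) +
        2 * K * (√(U.card : ℝ) / max (U.card : ℝ) h)) := by ring
    _ ≤ _ := by
        refine mul_le_mul_of_nonneg_left ?_ (recip_pos hh U).le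
        rw [mul_one_div] at h4
        linarith

namespace IsGapChain

variable (hc : IsGapChain P π γ)
include hc

/-- At each time the chance of being in `U` is π(U) plus an error that decays geometrically. The
errors sum to a multiple of √|U| that does not depend on `L`, so long blocks dilute them. -/
lemma sum_iterate_avg_ind_le {c n : ℝ} (hc0 : 0 < c) (hn : 0 < n) (hmin : ∀ v, c / n ≤ π v)
    {U : Finset V} (hU : ∀ v ∈ U, π v ≤ 2 / n) (L : ℕ) (x : V) :
    ∑ s ∈ Finset.range L, (avg P)^[s + 1] (ind U) x ≤
      L * (2 * U.card / n) + √(2 / c) / γ * √U.card := by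
  have hγ0 := hc.gap_pos
  have hγ1 : 0 ≤ 1 - γ := by linarith [hc.gap_le_one]
  have hs := sum_le_two_mul_card_div hU
  have h1 : √((∑ v ∈ U, π v) / π x) ≤ √(2 / c) * √U.card := by
    rw [← Real.sqrt_mul (by positivity)]
    refine Real.sqrt_le_sqrt ?_
    rw [div_le_iff₀ (hc.pos x)]
    calc _ ≤ 2 * U.card / n := hs
      _ = 2 / c * U.card * (c / n) := by field_simp
      _ ≤ _ := mul_le_mul_of_nonneg_left (hmin x) (by positivity)
  have h2 : ∑ s ∈ Finset.range L, (1 - γ) ^ (s + 1) ≤ 1 / γ := by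
    have hg := hasSum_geometric_of_lt_one hγ1 (by linarith)
    have := hg.summable.sum_le_tsum (Finset.range L) fun s _ => pow_nonneg hγ1 s
    rw [hg.tsum_eq, sub_sub_cancel, ← one_div] at this
    refine le_trans (Finset.sum_le_sum fun s _ => ?_) this
    exact pow_le_pow_of_le_one hγ1 (by linarith) (Nat.le_succ s)
  calc _ ≤ ∑ s ∈ Finset.range L,
        (2 * U.card / n + √(2 / c) * √U.card * (1 - γ) ^ (s + 1)) := by
        refine Finset.sum_le_sum fun s _ => (hc.iterate_avg_le _ (s + 1) x).trans ?_
        rw [wmean_ind, nsq_ind]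
        exact add_le_add hs (mul_le_mul_of_nonneg_right h1 (pow_nonneg hγ1 _))
    _ = L * (2 * U.card / n) + √(2 / c) * √U.card * ∑ s ∈ Finset.range L, (1 - γ) ^ (s + 1) := by
        rw [Finset.sum_add_distrib, ← Finset.mul_sum]; simp
    _ ≤ L * (2 * U.card / n) + √(2 / c) * √U.card * (1 / γ) :=
        add_le_add le_rfl (mul_le_mul_of_nonneg_left h2 (by positivity))
    _ = _ := by ring

/-- Growth of the truncated reciprocal along `L` steps from an arbitrary vertex. -/
lemma iterate_sweep_recip_le {c n h : ℝ} (hc0 : 0 < c) (hn : 0 < n) (hh : 0 < h)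
    (hmin : ∀ v, c / n ≤ π v) {U : Finset V} (hU : ∀ v ∈ U, π v ≤ 2 / n) {L : ℕ}
    (hL : (L : ℝ) ≤ h) (x : V) :
    (sweep P)^[L] (fun U _ => recip h U) U x ≤
      recip h U * (1 + 4 * L / n + 2 * (√(2 / c) / γ) / √h) := by
  have hb : 0 ≤ 2 * recip h U / max (U.card : ℝ) h :=
    div_nonneg (by linarith [recip_pos hh U]) (max_card_pos hh U).le
  have hγ0 := hc.gap_pos
  calc _ ≤ (sweep P)^[L] (fun U' _ => recip h U +
        2 * recip h U / max (U.card : ℝ) h * ((U.card : ℝ) - U'.card)) U x :=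
        iterate_sweep_le hc.nonneg L U (fun U' y hU' hcard => recip_le hh hU' hcard hL) x
    _ = recip h U + 2 * recip h U / max (U.card : ℝ) h *
        (sweep P)^[L] (fun U' _ => (U.card : ℝ) - U'.card) U x :=
        iterate_sweep_affine hc.row_sum _ _ (fun U' _ => (U.card : ℝ) - U'.card) L U x
    _ ≤ recip h U + 2 * recip h U / max (U.card : ℝ) h *
        (L * (2 * U.card / n) + √(2 / c) / γ * √U.card) := by
        refine add_le_add le_rfl (mul_le_mul_of_nonneg_left ?_ hb)
        have h1 := iterate_sweep_deficit_le hc.nonneg hc.row_sum (subset_refl U) L x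
        have h2 := hc.sum_iterate_avg_ind_le hc0 hn hmin hU L x
        linarith
    _ ≤ _ := recip_affine_le hh hn (Nat.cast_nonneg L) (by positivity)

/-- Growth of the truncated reciprocal along `L` steps started from stationarity. -/
lemma sum_iterate_sweep_recip_le {n h : ℝ} (hn : 0 < n) (hh : 0 < h) {U : Finset V}
    (hU : ∀ v ∈ U, π v ≤ 2 / n) {L : ℕ} (hL : ((L + 1 : ℕ) : ℝ) ≤ h) :
    ∑ x, π x * (sweep P)^[L] (fun U _ => recip h U) (U.erase x) x ≤
      recip h U * (1 + 4 * (L + 1) / n) := by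
  set b := 2 * recip h U / max (U.card : ℝ) h with hb
  have hb0 : 0 ≤ b := div_nonneg (by linarith [recip_pos hh U]) (max_card_pos hh U).le
  have h1 : ∀ x, (sweep P)^[L] (fun U _ => recip h U) (U.erase x) x ≤
      recip h U + b * ∑ s ∈ Finset.range (L + 1), (avg P)^[s] (ind U) x := by
    intro x
    calc _ ≤ (sweep P)^[L] (fun U' _ => recip h U + b * ((U.card : ℝ) - U'.card))
          (U.erase x) x := by
          refine iterate_sweep_le hc.nonneg L _ (fun U' y hU' hcard => ?_) x
          have := Finset.pred_card_le_card_erase (s := U) (a := x)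
          exact recip_le hh (hU'.trans (Finset.erase_subset _ _)) (by omega) hL
      _ = recip h U + b * (sweep P)^[L] (fun U' _ => (U.card : ℝ) - U'.card) (U.erase x) x :=
          iterate_sweep_affine hc.row_sum _ _ (fun U' _ => (U.card : ℝ) - U'.card) L _ x
      _ ≤ _ := by
          refine add_le_add le_rfl (mul_le_mul_of_nonneg_left ?_ hb0)
          have h2 := iterate_sweep_deficit_le hc.nonneg hc.row_sum (Finset.erase_subset x U) L x
          -- The starting vertex counts as a visit too, hence `L + 1` terms.
          have h3 := card_sub_ind_le (subset_refl U) x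
          rw [Finset.sum_range_succ']
          simp only [Function.iterate_zero, id]
          linarith
  calc _ ≤ ∑ x, π x * (recip h U + b * ∑ s ∈ Finset.range (L + 1), (avg P)^[s] (ind U) x) :=
        Finset.sum_le_sum fun x _ => mul_le_mul_of_nonneg_left (h1 x) (hc.pos x).le
    _ = recip h U + b * ∑ s ∈ Finset.range (L + 1), wmean π ((avg P)^[s] (ind U)) := by
        simp only [mul_add, Finset.sum_add_distrib, ← Finset.sum_mul, hc.sum_eq_one, one_mul]
        congr 1
        simp only [wmean, Finset.mul_sum]
        rw [Finset.sum_comm]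
        exact Finset.sum_congr rfl fun s _ => Finset.sum_congr rfl fun x _ => by ring
    _ = recip h U + b * ((L + 1) * ∑ v ∈ U, π v) := by
        simp [hc.wmean_iterate_avg, wmean_ind]
    _ ≤ recip h U + b * ((L + 1) * (2 * U.card / n) + 0 * √U.card) := by
        rw [zero_mul, add_zero]
        exact add_le_add le_rfl (mul_le_mul_of_nonneg_left (mul_le_mul_of_nonneg_left
          (sum_le_two_mul_card_div hU) (by positivity)) hb0)
    _ ≤ recip h U * (1 + 4 * (L + 1) / n + 2 * 0 / √h) :=
        recip_affine_le hh hn (by positivity) le_rfl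
    _ = _ := by simp

/-- The one-block factor is uniform over starting vertices and passes to subsets, so it can be
compounded block by block. -/
lemma iterate_sweep_mul_recip_le {c n h : ℝ} (hc0 : 0 < c) (hn : 0 < n) (hh : 0 < h)
    (hmin : ∀ v, c / n ≤ π v) {U : Finset V} (hU : ∀ v ∈ U, π v ≤ 2 / n) {L : ℕ}
    (hL : (L : ℝ) ≤ h) (J : ℕ) (x : V) :
    (sweep P)^[L * J] (fun U _ => recip h U) U x ≤
      (1 + 4 * L / n + 2 * (√(2 / c) / γ) / √h) ^ J * recip h U := by
  set r := 1 + 4 * L / n + 2 * (√(2 / c) / γ) / √h with hr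
  have hr0 : 0 ≤ r := by have := hc.gap_pos; positivity
  induction J generalizing U x with
  | zero => simp
  | succ J ih =>
    rw [Nat.mul_succ, add_comm, Function.iterate_add_apply]
    calc _ ≤ (sweep P)^[L] (fun U _ => 0 + r ^ J * recip h U) U x := by
          refine iterate_sweep_le hc.nonneg L U (fun U' y hU' _ => ?_) x
          rw [zero_add]
          exact ih (fun v hv => hU v (hU' hv)) y
      _ = 0 + r ^ J * (sweep P)^[L] (fun U _ => recip h U) U x :=
          iterate_sweep_affine hc.row_sum _ _ (fun U _ => recip h U) L U x
      _ ≤ 0 + r ^ J * (recip h U * r) := by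
          have := hc.iterate_sweep_recip_le hc0 hn hh hmin hU hL x
          exact add_le_add le_rfl (mul_le_mul_of_nonneg_left this (pow_nonneg hr0 J))
      _ = _ := by ring

/-- Growth of the truncated reciprocal along a stationary walk of length `t`. -/
lemma sum_iterate_sweep_recip_le_exp {c n h : ℝ} (hc0 : 0 < c) (hn : 0 < n) (hh : 0 < h)
    (hmin : ∀ v, c / n ≤ π v) {U : Finset V} (hU : ∀ v ∈ U, π v ≤ 2 / n) {L : ℕ} (hL0 : 0 < L)
    (hL : (L : ℝ) ≤ h) (t : ℕ) :
    ∑ x, π x * (sweep P)^[t] (fun U _ => recip h U) (U.erase x) x ≤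
      Real.exp (4 * (t + 1) / n + t / L * (2 * (√(2 / c) / γ) / √h)) * recip h U := by
  set K := 2 * (√(2 / c) / γ) / √h with hK
  have hK0 : 0 ≤ K := by have := hc.gap_pos; positivity
  set r := 1 + 4 * L / n + K with hr
  have hr0 : 0 ≤ r := by positivity
  -- The incomplete block is put first, where stationarity removes the 1/√h error. Otherwise each of
  -- up to n walks, however short, would pay that error once, which is too much.
  have hmod : t % L + L * (t / L) = t := Nat.mod_add_div t L
  have hmodL : t % L < L := Nat.mod_lt t hL0
  have hLpos : (0 : ℝ) < L := by exact_mod_cast hL0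
  calc _ ≤ ∑ x, π x * (r ^ (t / L) *
        (sweep P)^[t % L] (fun U _ => recip h U) (U.erase x) x) := by
        refine Finset.sum_le_sum fun x _ => mul_le_mul_of_nonneg_left ?_ (hc.pos x).le
        conv_lhs => rw [← hmod, Function.iterate_add_apply]
        calc _ ≤ (sweep P)^[t % L] (fun U _ => 0 + r ^ (t / L) * recip h U) (U.erase x) x := by
              refine iterate_sweep_le hc.nonneg _ _ (fun U' y hU' _ => ?_) x
              rw [zero_add]
              exact hc.iterate_sweep_mul_recip_le hc0 hn hh hmin
                (fun v hv => hU v (Finset.erase_subset _ _ (hU' hv))) hL _ y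
          _ = 0 + _ := iterate_sweep_affine hc.row_sum _ _ (fun U _ => recip h U) _ _ x
          _ = _ := zero_add _
    _ = r ^ (t / L) * ∑ x, π x * (sweep P)^[t % L] (fun U _ => recip h U) (U.erase x) x := by
        rw [Finset.mul_sum]; exact Finset.sum_congr rfl fun x _ => by ring
    _ ≤ r ^ (t / L) * (recip h U * (1 + 4 * ((t % L : ℕ) + 1) / n)) := by
        refine mul_le_mul_of_nonneg_left (hc.sum_iterate_sweep_recip_le hn hh hU ?_)
          (pow_nonneg hr0 _)
        refine le_trans ?_ hL
        exact_mod_cast hmodL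
    _ ≤ Real.exp (4 * L / n + K) ^ (t / L) *
        (recip h U * Real.exp (4 * ((t % L : ℕ) + 1) / n)) := by
        have h1 := Real.add_one_le_exp (4 * L / n + K)
        have h2 := Real.add_one_le_exp (4 * ((t % L : ℕ) + 1) / n)
        refine mul_le_mul (pow_le_pow_left₀ hr0 (by linarith) _)
          (mul_le_mul_of_nonneg_left (by linarith) (recip_pos hh U).le) ?_ (by positivity)
        exact mul_nonneg (recip_pos hh U).le (by positivity)
    _ = Real.exp ((t / L : ℕ) * (4 * L / n + K) + 4 * ((t % L : ℕ) + 1) / n) * recip h U := by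
        rw [← Real.exp_nat_mul, Real.exp_add]; ring
    _ ≤ _ := by
        refine mul_le_mul_of_nonneg_right (Real.exp_le_exp.2 ?_) (recip_pos hh U).le
        have h1 : ((t / L : ℕ) : ℝ) ≤ t / L := Nat.cast_div_le
        have h2 : ((t % L : ℕ) : ℝ) + L * (t / L : ℕ) = t := by exact_mod_cast hmod
        have h3 : 4 * ((t : ℝ) + 1) / n =
            (t / L : ℕ) * (4 * L / n) + 4 * ((t % L : ℕ) + 1) / n := by
          rw [← h2]; ring
        have h4 := mul_le_mul_of_nonneg_right h1 hK0
        rw [h3]; linarith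

end IsGapChain

end Potential

/-! ### Probability that stationary walks cover -/

section Lower

variable {V : Type*} [Fintype V] [DecidableEq V] [MeasurableSpace V] [MeasurableSingletonClass V]

/-- The elements of `U` that none of the trajectories `X i` has visited up to time `t`. -/
def unvisitedAll {k : ℕ} (U : Finset V) (X : Fin k → ℕ → V) (t : ℕ) : Finset V :=
  U.filter fun v => ∀ i, ∀ s ≤ t, X i s ≠ v

/-- Allows simultaneous walks to be revealed one at a time, each facing only what the earlier ones
left. -/
lemma unvisitedAll_cons {k : ℕ} (U : Finset V) (x : ℕ → V) (Y : Fin k → ℕ → V) (t : ℕ) :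
    unvisitedAll U (Fin.cons x Y : Fin (k + 1) → ℕ → V) t =
      unvisitedAll (unvisited U x t) Y t := by
  ext v
  simp only [unvisitedAll, Finset.mem_filter, mem_unvisited, Fin.forall_fin_succ, Fin.cons_zero,
    Fin.cons_succ, and_assoc]

lemma measurable_unvisitedAll {k : ℕ} (U : Finset V) (t : ℕ) (g : Finset V → ℝ≥0∞) :
    Measurable fun X : Fin k → ℕ → V => g (unvisitedAll U X t) := by
  have h : (fun X : Fin k → ℕ → V => g (unvisitedAll U X t)) =
      (fun H : Fin k → Finset.Iic t → V => g (U.filter fun v => ∀ i j, H i j ≠ v)) ∘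
        fun X i => Preorder.frestrictLe (π := fun _ => V) t (X i) := by
    refine funext fun X => congrArg g (Finset.ext fun v => ?_)
    simp only [unvisitedAll, Finset.mem_filter, Subtype.forall, Finset.mem_Iic,
      Preorder.frestrictLe_apply]
  rw [h]
  refine Measurable.of_discrete.comp (measurable_pi_lambda _ fun i => ?_)
  exact (Preorder.measurable_frestrictLe t).comp (measurable_pi_apply i)

/-- Running the walks one after the other multiplies the growth factors. -/
lemma lintegral_recip_unvisitedAll_le {ν : Measure (ℕ → V)} [IsProbabilityMeasure ν] {h : ℝ}
    {U₀ : Finset V} {t : ℕ} {q : ℝ≥0∞}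
    (hq : ∀ U ⊆ U₀, ∫⁻ X, ENNReal.ofReal (recip h (unvisited U X t)) ∂ν ≤
      q * ENNReal.ofReal (recip h U)) (k : ℕ) {U : Finset V} (hU : U ⊆ U₀) :
    ∫⁻ X, ENNReal.ofReal (recip h (unvisitedAll U X t)) ∂Measure.pi (fun _ : Fin k => ν) ≤
      q ^ k * ENNReal.ofReal (recip h U) := by
  induction k generalizing U with
  | zero => simp [unvisitedAll]
  | succ k ih =>
    rw [lintegral_pi_succ _ (measurable_unvisitedAll U t fun U => ENNReal.ofReal (recip h U))]
    simp only [unvisitedAll_cons]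
    calc _ ≤ ∫⁻ x, q ^ k * ENNReal.ofReal (recip h (unvisited U x t)) ∂ν :=
          lintegral_mono fun x => ih (Finset.sdiff_subset.trans hU)
      _ ≤ q ^ k * (q * ENNReal.ofReal (recip h U)) := by
          have hm : Measurable fun x : ℕ → V => ENNReal.ofReal (recip h (unvisited U x t)) := by
            have := (measurable_unvisitedAll (k := 1) U t fun U => ENNReal.ofReal (recip h U)).comp
              (measurable_pi_lambda (fun (x : ℕ → V) (_ : Fin 1) => x) fun _ => measurable_id)
            refine (congrArg Measurable (funext fun x => ?_)).mp this
            simp only [Function.comp_apply]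
            congr 2
            ext v
            simp [unvisitedAll, mem_unvisited]
          rw [lintegral_const_mul _ hm]
          exact mul_le_mul_right (hq U hU) _
      _ = _ := by rw [pow_succ, mul_assoc]

variable {G : SimpleGraph V} [DecidableRel G.Adj]

lemma stationaryLaw_eq : stationaryLaw G = weighted (stationary G) := rfl

lemma card_le_two_mul_card_filter {n : ℝ} (hn : n = Fintype.card V) (hn0 : 0 < n) {π : V → ℝ}
    (hπ : ∀ v, 0 < π v) (h1 : ∑ v, π v = 1) :
    n ≤ 2 * (Finset.univ.filter fun v => π v ≤ 2 / n).card := by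
  have h2 := Finset.card_filter_add_card_filter_not (s := (Finset.univ : Finset V))
    (fun v => π v ≤ 2 / n)
  have h3 : ((Finset.univ.filter fun v => ¬ π v ≤ 2 / n).card : ℝ) * (2 / n) ≤ 1 := by
    rw [← h1, ← nsmul_eq_mul, ← Finset.sum_const]
    refine (Finset.sum_le_sum fun v hv => ?_).trans
      (Finset.sum_le_univ_sum_of_nonneg fun v => (hπ v).le)
    exact (not_le.1 (Finset.mem_filter.1 hv).2).le
  have h4 : ((Finset.univ.filter fun v => π v ≤ 2 / n).card : ℝ) +
      (Finset.univ.filter fun v => ¬ π v ≤ 2 / n).card = n := by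
    rw [← Nat.cast_add, h2, Finset.card_univ, hn]
  rw [mul_div_assoc', div_le_one hn0] at h3
  linarith

/-- The probability that `k` stationary walks cover the graph by time `t`. -/
theorem measure_covered_le {γ c h : ℝ} (hP : IsGapChain (transition G) (stationary G) γ)
    (hc0 : 0 < c) (hcard : 0 < Fintype.card V)
    (hmin : ∀ v, c / Fintype.card V ≤ stationary G v) {L : ℕ} (hL0 : 0 < L) (hL : (L : ℝ) ≤ h)
    (k t : ℕ) :
    (Measure.pi fun _ : Fin k => walkLaw G (stationaryLaw G)) (uncovered V k t)ᶜ ≤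
      ENNReal.ofReal (2 * h / Fintype.card V * Real.exp (4 * (k * (t + 1)) / Fintype.card V +
        k * t / L * (2 * (√(2 / c) / γ) / √h))) := by
  set n : ℝ := (Fintype.card V : ℝ) with hn
  have hn0 : 0 < n := by rw [hn]; exact_mod_cast hcard
  have hh : 0 < h := lt_of_lt_of_le (by exact_mod_cast hL0) hL
  have hprob : IsProbabilityMeasure (stationaryLaw G) :=
    isProbabilityMeasure_weighted (fun v => (hP.pos v).le) hP.sum_eq_one
  have hprob' := isProbabilityMeasure_walkLaw (G := G) (stationaryLaw G)
  set U₀ : Finset V := Finset.univ.filter fun v => stationary G v ≤ 2 / n with hU₀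
  set e := 4 * ((t : ℝ) + 1) / n + t / L * (2 * (√(2 / c) / γ) / √h) with he
  have hq : ∀ U ⊆ U₀, ∫⁻ X, ENNReal.ofReal (recip h (unvisited U X t))
      ∂walkLaw G (stationaryLaw G) ≤
      ENNReal.ofReal (Real.exp e) * ENNReal.ofReal (recip h U) := by
    intro U hU
    rw [stationaryLaw_eq, lintegral_unvisited (fun v => (hP.pos v).le) hP.sum_eq_one t U
      (F := fun U _ => recip h U) (fun U _ => (recip_pos hh U).le),
      ← ENNReal.ofReal_mul (Real.exp_pos _).le]
    exact ENNReal.ofReal_le_ofReal (hP.sum_iterate_sweep_recip_le_exp hc0 hn0 hh hmin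
      (fun v hv => (Finset.mem_filter.1 (hU hv)).2) hL0 hL t)
  have h1 := lintegral_recip_unvisitedAll_le hq k (subset_refl U₀)
  -- Markov's inequality: once everything is covered, the potential equals 1/h.
  have h2 : ENNReal.ofReal (1 / h) * (Measure.pi fun _ : Fin k => walkLaw G (stationaryLaw G))
      (uncovered V k t)ᶜ ≤ ∫⁻ X, ENNReal.ofReal (recip h (unvisitedAll U₀ X t))
        ∂Measure.pi (fun _ : Fin k => walkLaw G (stationaryLaw G)) := by
    rw [← lintegral_indicator_one (measurableSet_uncovered k t).compl,
      ← lintegral_const_mul _ (measurable_one.indicator (measurableSet_uncovered k t).compl)]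
    refine lintegral_mono fun X => ?_
    by_cases hX : X ∈ uncovered V k t
    · simp [hX]
    · have h3 : unvisitedAll U₀ X t = ∅ := by
        refine Finset.filter_eq_empty_iff.2 fun v _ h4 => hX ?_
        exact Set.mem_iUnion.2 ⟨v, fun i _ => h4 i⟩
      simp [hX, h3, recip, max_eq_right hh.le]
  have h3 : recip h U₀ ≤ 2 / n := by
    have h4 := card_le_two_mul_card_filter hn hn0 hP.pos hP.sum_eq_one
    rw [recip, ← one_div_div n 2]
    refine one_div_le_one_div_of_le (by positivity) (le_max_of_le_left ?_)
    rw [← hU₀] at h4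
    linarith
  have h4 : ENNReal.ofReal h * ENNReal.ofReal (1 / h) = 1 := by
    rw [← ENNReal.ofReal_mul hh.le, mul_one_div_cancel hh.ne', ENNReal.ofReal_one]
  calc _ = ENNReal.ofReal h * (ENNReal.ofReal (1 / h) *
        (Measure.pi fun _ : Fin k => walkLaw G (stationaryLaw G)) (uncovered V k t)ᶜ) := by
        rw [← mul_assoc, h4, one_mul]
    _ ≤ ENNReal.ofReal h * (ENNReal.ofReal (Real.exp e) ^ k * ENNReal.ofReal (2 / n)) := by
        refine mul_le_mul_right ((h2.trans h1).trans ?_) _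
        exact mul_le_mul_right (ENNReal.ofReal_le_ofReal h3) _
    _ = ENNReal.ofReal (h * (Real.exp e ^ k * (2 / n))) := by
        rw [ENNReal.ofReal_mul hh.le, ENNReal.ofReal_mul (by positivity),
          ENNReal.ofReal_pow (Real.exp_pos _).le]
    _ = _ := by
        rw [← Real.exp_nat_mul, he]
        congr 1
        have : (k : ℝ) * (4 * ((t : ℝ) + 1) / n + t / L * (2 * (√(2 / c) / γ) / √h)) =
          4 * (k * (t + 1)) / n + k * t / L * (2 * (√(2 / c) / γ) / √h) := by ring
        rw [this]; ring

/-- A lower bound on the probability of not covering gives lower bounds on both cover times. -/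
theorem le_coverTimes {γ : ℝ} (hP : IsGapChain (transition G) (stationary G) γ) {k t : ℕ}
    {δ : ℝ} (hδ : ENNReal.ofReal δ ≤
      (Measure.pi fun _ : Fin k => walkLaw G (stationaryLaw G)) (uncovered V k t)) :
    ENNReal.ofReal ((t + 1) * δ) ≤ stationaryCoverTime G k ∧
      ENNReal.ofReal ((t + 1) * δ) ≤ worstCoverTime G k := by
  have hprob : IsProbabilityMeasure (stationaryLaw G) :=
    isProbabilityMeasure_weighted (fun v => (hP.pos v).le) hP.sum_eq_one
  have hprob' := isProbabilityMeasure_walkLaw (G := G) (stationaryLaw G)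
  have hprob2 := fun v : V => isProbabilityMeasure_walkLaw (G := G) (Measure.dirac v)
  have ht : ENNReal.ofReal ((t + 1) * δ) = ((t + 1 : ℕ) : ℝ≥0∞) * ENNReal.ofReal δ := by
    rw [ENNReal.ofReal_mul (by positivity), ← Nat.cast_add_one, ENNReal.ofReal_natCast]
  rw [ht]
  refine ⟨(mul_le_mul_right hδ _).trans (le_expectedCoverTime _ t), ?_⟩
  have hw : ∑ v, ENNReal.ofReal (stationary G v) = 1 := by
    rw [← ENNReal.ofReal_sum_of_nonneg fun w _ => (hP.pos w).le, hP.sum_eq_one,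
      ENNReal.ofReal_one]
  -- Some deterministic starts do at least as well as the stationary average at leaving the graph
  -- uncovered.
  have h1 := lintegral_pi_mixture_le hw (ν := walkLaw G (stationaryLaw G))
    (fun f hf => walkLaw_weighted f hf) k
    (measurable_one.indicator (measurableSet_uncovered k t))
  simp only [lintegral_indicator_one (measurableSet_uncovered k t)] at h1
  refine (mul_le_mul_right (hδ.trans h1) _).trans ?_
  rw [ENNReal.mul_iSup]
  exact iSup_mono fun u => le_expectedCoverTime _ t

/-- The graph is not covered at time `0` with probability at least `2⁻ⁿ`. -/
lemma le_measure_uncovered_zero {γ : ℝ} (hP : IsGapChain (transition G) (stationary G) γ)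
    (hcard : 2 ≤ Fintype.card V) {k : ℕ} (hk : k ≤ Fintype.card V) :
    ENNReal.ofReal ((1 / 2) ^ Fintype.card V) ≤
      (Measure.pi fun _ : Fin k => walkLaw G (stationaryLaw G)) (uncovered V k 0) := by
  have hprob : IsProbabilityMeasure (stationaryLaw G) :=
    isProbabilityMeasure_weighted (fun v => (hP.pos v).le) hP.sum_eq_one
  have hprob' := isProbabilityMeasure_walkLaw (G := G) (stationaryLaw G)
  have hn2 : (2 : ℝ) ≤ Fintype.card V := by exact_mod_cast hcard
  have : Nonempty V := Fintype.card_pos_iff.1 (by omega)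
  -- The average of π over vertices is 1/n, so some vertex has π(v) ≤ 1/n ≤ 1/2, and each walk
  -- starts elsewhere with probability at least 1/2.
  obtain ⟨v, -, hv⟩ : ∃ v ∈ (Finset.univ : Finset V),
      stationary G v ≤ 1 / (Fintype.card V : ℝ) := by
    refine Finset.exists_le_of_sum_le Finset.univ_nonempty ?_
    rw [hP.sum_eq_one, Finset.sum_const, Finset.card_univ, nsmul_eq_mul,
      mul_one_div_cancel (by linarith)]
  have hv2 : stationary G v ≤ 1 / 2 :=
    hv.trans (one_div_le_one_div_of_le (by norm_num) hn2)
  refine le_trans ?_ (measure_mono (Set.subset_iUnion _ v))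
  rw [Measure.pi_pi, Finset.prod_const, Finset.card_univ, Fintype.card_fin, stationaryLaw_eq,
    walkLaw_avoid (fun v => (hP.pos v).le) hP.sum_eq_one, ← ENNReal.ofReal_pow]
  · refine ENNReal.ofReal_le_ofReal ?_
    have h1 : ∑ x, stationary G x * survive (transition G) v 0 x = 1 - stationary G v := by
      rw [← hP.sum_eq_one, ← Finset.add_sum_erase _ _ (Finset.mem_univ v),
        ← Finset.add_sum_erase _ (stationary G) (Finset.mem_univ v), survive_self]
      have : ∑ x ∈ Finset.univ.erase v, stationary G x * survive (transition G) v 0 x =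
          ∑ x ∈ Finset.univ.erase v, stationary G x := by
        refine Finset.sum_congr rfl fun x hx => ?_
        simp [survive, Finset.ne_of_mem_erase hx]
      rw [this]; ring
    rw [h1]
    calc ((1 : ℝ) / 2) ^ Fintype.card V ≤ (1 / 2) ^ k :=
          pow_le_pow_of_le_one (by norm_num) (by norm_num) hk
      _ ≤ _ := pow_le_pow_left₀ (by norm_num) (by linarith) k
  · exact Finset.sum_nonneg fun x _ => mul_nonneg (hP.pos x).le
      (survive_nonneg hP.nonneg _ _ _)

end Lower

/-! ### Choice of scales and the lower bound -/

lemma exists_threshold (K : ℝ) : ∃ N : ℕ, ∀ n : ℕ, N ≤ n →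
    4 * Real.exp 5 ≤ (n : ℝ) ^ (1 / 8 : ℝ) ∧ K / 16 * Real.log n ≤ (n : ℝ) ^ (1 / 8 : ℝ) := by
  have h1 : ∀ᶠ x : ℝ in Filter.atTop, 4 * Real.exp 5 ≤ x ^ (1 / 8 : ℝ) :=
    (tendsto_rpow_atTop (by norm_num)).eventually_ge_atTop _
  have h2 : ∀ᶠ x : ℝ in Filter.atTop, K / 16 * Real.log x ≤ x ^ (1 / 8 : ℝ) := by
    have h3 := ((isLittleO_log_rpow_atTop (by norm_num : (0 : ℝ) < 1 / 8)).const_mul_left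
      (K / 16)).bound one_pos
    filter_upwards [h3, Filter.eventually_ge_atTop 0] with x hx hx0
    rw [one_mul, Real.norm_of_nonneg (Real.rpow_nonneg hx0 _)] at hx
    exact (Real.le_norm_self _).trans hx
  obtain ⟨N, hN⟩ := Filter.eventually_atTop.1
    (tendsto_natCast_atTop_atTop.eventually (h1.and h2))
  exact ⟨N, hN⟩

/-- With s = n^{1/8} and h = s^6, the main exponent is at most l/8 + 4. The mixing exponent is at
most (K l/16)/s ≤ 1, because s^6 · s^3 exceeds n by one factor of s. The total is at most 2e^5/s. -/
lemma covered_bound_le_half {n s K l kt k L : ℝ} (hs8 : s ^ 8 = n) (hl : Real.exp (l / 8) = s)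
    (hs : 4 * Real.exp 5 ≤ s) (hK0 : 0 ≤ K) (hK : K / 16 * l ≤ s) (hkt0 : 0 ≤ kt)
    (hkt : kt ≤ n * l / 32) (hk : k ≤ n) (hL : s ^ 6 / 2 ≤ L) :
    2 * s ^ 6 / n * Real.exp (4 * (kt + k) / n + kt / L * (K / √(s ^ 6))) ≤ 1 / 2 := by
  have hs0 : 0 < s := lt_of_lt_of_le (by positivity) hs
  have hn0 : 0 < n := by rw [← hs8]; positivity
  have hsq : √(s ^ 6) = s ^ 3 := by
    rw [show s ^ 6 = (s ^ 3) ^ 2 by ring, Real.sqrt_sq (by positivity)]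
  have h1 : 4 * (kt + k) / n ≤ l / 8 + 4 := by
    rw [div_le_iff₀ hn0]; linarith
  have h2 : kt / L * (K / √(s ^ 6)) ≤ 1 := by
    rw [hsq]
    calc kt / L * (K / s ^ 3) ≤ (n * l / 32) / (s ^ 6 / 2) * (K / s ^ 3) := by
          refine mul_le_mul_of_nonneg_right ?_ (by positivity)
          exact div_le_div₀ (hkt0.trans hkt) hkt (by positivity) hL
      _ = (K / 16 * l) / s := by rw [← hs8]; field_simp; ring
      _ ≤ 1 := by rw [div_le_one hs0]; exact hK
  calc _ ≤ 2 * s ^ 6 / n * Real.exp (l / 8 + 5) :=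
        mul_le_mul_of_nonneg_left (Real.exp_le_exp.2 (by linarith)) (by positivity)
    _ = 2 * Real.exp 5 / s := by rw [Real.exp_add, hl, ← hs8]; field_simp
    _ ≤ 1 / 2 := by rw [div_le_iff₀ hs0]; linarith

/-- The lower bounds on the cover times, with a constant that depends only on the spectral gap and
on the minimal stationary probability. -/
theorem exists_lower_constant {γ c : ℝ} (hγ : 0 < γ) (hc0 : 0 < c) :
    ∃ a : ℝ, 0 < a ∧ ∀ (V : Type*) [Fintype V] [DecidableEq V] [MeasurableSpace V]
      [MeasurableSingletonClass V] (G : SimpleGraph V) [DecidableRel G.Adj],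
      2 ≤ Fintype.card V → IsGapChain (transition G) (stationary G) γ →
      (∀ v, c / Fintype.card V ≤ stationary G v) →
      ∀ k : ℕ, 1 ≤ k → k ≤ Fintype.card V →
        ENNReal.ofReal (a * ((Fintype.card V : ℝ) / k * Real.log (Fintype.card V))) ≤
          stationaryCoverTime G k ∧
        ENNReal.ofReal (a * ((Fintype.card V : ℝ) / k * Real.log (Fintype.card V))) ≤
          worstCoverTime G k := by
  obtain ⟨N, hN⟩ := exists_threshold (2 * (√(2 / c) / γ))
  -- 1/64 serves large n: the time is R/32 and the probability 1/2. The other entry serves n < N,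
  -- where R ≤ (N + 1)² and time 0 is uncovered with probability at least 2^{-N}.
  refine ⟨min (1 / 64) ((1 / 2) ^ N / (N + 1) ^ 2), by positivity, ?_⟩
  intro V _ _ _ _ G _ hcard hP hmin k hk1 hkn
  set a : ℝ := min (1 / 64) ((1 / 2) ^ N / (N + 1) ^ 2) with ha
  set n := Fintype.card V with hn
  have hn2 : (2 : ℝ) ≤ n := by exact_mod_cast hcard
  have hn0 : (0 : ℝ) < n := by linarith
  have hk0 : (1 : ℝ) ≤ k := by exact_mod_cast hk1
  have hkn' : (k : ℝ) ≤ n := by exact_mod_cast hkn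
  have hlog : 0 ≤ Real.log n := Real.log_nonneg (by linarith)
  set R := (n : ℝ) / k * Real.log n with hR
  have hR0 : 0 ≤ R := by positivity
  suffices h : ∃ t : ℕ, ∃ δ : ℝ, a * R ≤ (t + 1) * δ ∧ ENNReal.ofReal δ ≤
      (Measure.pi fun _ : Fin k => walkLaw G (stationaryLaw G)) (uncovered V k t) by
    obtain ⟨t, δ, hδ, hm⟩ := h
    obtain ⟨h1, h2⟩ := le_coverTimes hP hm
    exact ⟨(ENNReal.ofReal_le_ofReal hδ).trans h1, (ENNReal.ofReal_le_ofReal hδ).trans h2⟩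
  rcases le_or_gt N n with hNn | hNn
  · obtain ⟨hs, hK⟩ := hN n hNn
    set s := (n : ℝ) ^ (1 / 8 : ℝ) with hs_def
    have hs8 : s ^ 8 = n := by
      rw [hs_def, ← Real.rpow_natCast, ← Real.rpow_mul hn0.le]; norm_num
    have hl : Real.exp (Real.log n / 8) = s := by
      rw [hs_def, Real.rpow_def_of_pos hn0]; congr 1; ring
    have hs2 : 2 ≤ s := by
      have := Real.add_one_le_exp 5
      linarith
    have hs6 : 2 ≤ s ^ 6 := hs2.trans (le_self_pow₀ (by linarith) (by norm_num))
    have hfl : s ^ 6 / 2 ≤ (⌊s ^ 6⌋₊ : ℝ) := by linarith [Nat.lt_floor_add_one (s ^ 6)]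
    set t := ⌊R / 32⌋₊ with ht
    have htR : (t : ℝ) ≤ R / 32 := Nat.floor_le (by positivity)
    have hktle : (k : ℝ) * t ≤ n * Real.log n / 32 := by
      have : (k : ℝ) * (R / 32) = n * Real.log n / 32 := by rw [hR]; field_simp
      rw [← this]
      exact mul_le_mul_of_nonneg_left htR (by linarith)
    have hcov := measure_covered_le hP hc0 (by omega) hmin (L := ⌊s ^ 6⌋₊)
      (Nat.floor_pos.2 (by linarith)) (Nat.floor_le (by positivity)) k t
    have hhalf := covered_bound_le_half hs8 hl hs (K := 2 * (√(2 / c) / γ)) (by positivity) hK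
      (kt := k * t) (by positivity) hktle hkn' hfl
    refine ⟨t, 1 / 2, ?_, ?_⟩
    · have h1 := Nat.lt_floor_add_one (R / 32)
      have h2 : a * R ≤ 1 / 64 * R := mul_le_mul_of_nonneg_right (min_le_left _ _) hR0
      linarith
    · have hprob : IsProbabilityMeasure (stationaryLaw G) :=
        isProbabilityMeasure_weighted (fun v => (hP.pos v).le) hP.sum_eq_one
      have hprob' := isProbabilityMeasure_walkLaw (G := G) (stationaryLaw G)
      have h3 := hcov.trans (ENNReal.ofReal_le_ofReal
        (le_trans (le_of_eq (by rw [mul_add, mul_one])) hhalf))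
      rw [prob_compl_eq_one_sub (measurableSet_uncovered k t), tsub_le_iff_left] at h3
      have h4 : ENNReal.ofReal (1 / 2) + ENNReal.ofReal (1 / 2) = 1 := by
        rw [← ENNReal.ofReal_add (by norm_num) (by norm_num)]; norm_num
      rw [← h4] at h3
      exact (ENNReal.add_le_add_iff_right ENNReal.ofReal_ne_top).1 h3
  · refine ⟨0, (1 / 2) ^ n, ?_, le_measure_uncovered_zero hP hcard hkn⟩
    have hnN : (n : ℝ) ≤ N := by exact_mod_cast hNn.le
    have h1 : R ≤ (N + 1) ^ 2 := by
      have h2 : (n : ℝ) / k ≤ n := div_le_self hn0.le hk0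
      have h3 : Real.log n ≤ n := (Real.log_le_sub_one_of_pos hn0).trans (by linarith)
      calc R ≤ n * n := mul_le_mul h2 h3 hlog hn0.le
        _ ≤ _ := by nlinarith
    calc a * R ≤ (1 / 2) ^ N / (N + 1) ^ 2 * (N + 1) ^ 2 :=
          mul_le_mul (min_le_right _ _) h1 hR0 (by positivity)
      _ = (1 / 2) ^ N := by field_simp
      _ ≤ (1 / 2) ^ n := pow_le_pow_of_le_one (by norm_num) (by norm_num) hNn.le
      _ = ((0 : ℕ) + 1) * (1 / 2) ^ n := by norm_num

end MultiWalk

/-! ### Assembly of the two bounds -/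

theorem theorem5p11 (C c : ℝ) (hC : 0 < C) (hc : 0 < c) :
    ∃ a b : ℝ, 0 < a ∧ 0 < b ∧
      ∀ (V : Type*) [Fintype V] [DecidableEq V] [MeasurableSpace V] [MeasurableSingletonClass V]
        (G : SimpleGraph V) [DecidableRel G.Adj],
        2 ≤ Fintype.card V → G.Connected →
        MultiWalk.relaxationTime G ≤ C →
        c / (Fintype.card V : ℝ) ≤ MultiWalk.stationaryMin G →
        ∀ k : ℕ, 1 ≤ k → k ≤ Fintype.card V →
          (ENNReal.ofReal (a * ((Fintype.card V : ℝ) / k * Real.log (Fintype.card V))) ≤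
              MultiWalk.stationaryCoverTime G k ∧
            MultiWalk.stationaryCoverTime G k ≤
              ENNReal.ofReal (b * ((Fintype.card V : ℝ) / k * Real.log (Fintype.card V)))) ∧
          (ENNReal.ofReal (a * ((Fintype.card V : ℝ) / k * Real.log (Fintype.card V))) ≤
              MultiWalk.worstCoverTime G k ∧
            MultiWalk.worstCoverTime G k ≤
              ENNReal.ofReal (b * ((Fintype.card V : ℝ) / k * Real.log (Fintype.card V)))) ∧
          (ENNReal.ofReal a * MultiWalk.stationaryCoverTime G k ≤ MultiWalk.worstCoverTime G k ∧
            MultiWalk.worstCoverTime G k ≤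
              ENNReal.ofReal b * MultiWalk.stationaryCoverTime G k) := by
  -- Replacing `C` by max(C, 1) and `c` by min(c, 1) only weakens the hypotheses and secures γ ≤ 1
  -- and c₁ ≤ 1.
  set γ : ℝ := 1 / max C 1 with hγ
  set c₁ : ℝ := min c 1 with hc₁
  have hγ0 : 0 < γ := by positivity
  have hc0 : 0 < c₁ := lt_min hc one_pos
  have hc1 : c₁ ≤ 1 := min_le_right _ _
  obtain ⟨a, ha, hlow⟩ := MultiWalk.exists_lower_constant hγ0 hc0
  set b : ℝ := (2 + 2 * Real.log (1 / c₁)) / γ + 10 + 7 / (γ * c₁) with hb_def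
  have hlog : 0 ≤ Real.log (1 / c₁) :=
    Real.log_nonneg (by rw [le_div_iff₀ hc0]; linarith)
  have hb : 0 < b := by positivity
  -- The entries a/b and b/a serve the comparison of the two cover times, each of which lies between
  -- aR and bR.
  refine ⟨min a (a / b), max b (b / a), by positivity, by positivity, ?_⟩
  intro V _ _ _ _ G _ hcard hG hrel hmin k hk1 hkn
  have hP := MultiWalk.isGapChain_transition hcard hG (le_max_right C 1)
    (hrel.trans (le_max_left C 1))
  have hmin' : ∀ v, c₁ / (Fintype.card V : ℝ) ≤ MultiWalk.stationary G v := fun v =>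
    (div_le_div_of_nonneg_right (min_le_left c 1) (Nat.cast_nonneg _)).trans
      (hmin.trans (MultiWalk.stationaryMin_le v))
  obtain ⟨hs1, hw1⟩ := hlow V G hcard hP hmin' k hk1 hkn
  have hs2 : MultiWalk.stationaryCoverTime G k ≤
      ENNReal.ofReal (b * ((Fintype.card V : ℝ) / k * Real.log (Fintype.card V))) :=
    MultiWalk.expectedCoverTime_le hP hc0 hc1 hcard hmin' hk1 hkn
      (p := fun _ => MultiWalk.stationary G) (fun _ v => (hP.pos v).le) fun _ => hP.sum_eq_one
  have hw2 : MultiWalk.worstCoverTime G k ≤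
      ENNReal.ofReal (b * ((Fintype.card V : ℝ) / k * Real.log (Fintype.card V))) := by
    refine iSup_le fun u => ?_
    simp only [MultiWalk.dirac_eq_weighted]
    refine MultiWalk.expectedCoverTime_le hP hc0 hc1 hcard hmin' hk1 hkn (fun i v => ?_)
      fun i => ?_
    · by_cases h : v = u i
      · subst h; simp
      · simp [h]
    · simp
  have hR : 0 ≤ (Fintype.card V : ℝ) / k * Real.log (Fintype.card V) :=
    mul_nonneg (by positivity) (Real.log_natCast_nonneg _)
  set R := (Fintype.card V : ℝ) / k * Real.log (Fintype.card V)
  have hlo : ENNReal.ofReal (min a (a / b) * R) ≤ ENNReal.ofReal (a * R) :=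
    ENNReal.ofReal_le_ofReal (mul_le_mul_of_nonneg_right (min_le_left _ _) hR)
  have hup : ENNReal.ofReal (b * R) ≤ ENNReal.ofReal (max b (b / a) * R) :=
    ENNReal.ofReal_le_ofReal (mul_le_mul_of_nonneg_right (le_max_left _ _) hR)
  refine ⟨⟨hlo.trans hs1, hs2.trans hup⟩, ⟨hlo.trans hw1, hw2.trans hup⟩, ?_, ?_⟩
  · calc ENNReal.ofReal (min a (a / b)) * MultiWalk.stationaryCoverTime G k
        ≤ ENNReal.ofReal (a / b) * ENNReal.ofReal (b * R) :=
          mul_le_mul' (ENNReal.ofReal_le_ofReal (min_le_right _ _)) hs2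
      _ = ENNReal.ofReal (a * R) := by
          rw [← ENNReal.ofReal_mul (by positivity)]; congr 1; field_simp
      _ ≤ _ := hw1
  · calc MultiWalk.worstCoverTime G k ≤ ENNReal.ofReal (b * R) := hw2
      _ = ENNReal.ofReal (b / a) * ENNReal.ofReal (a * R) := by
          rw [← ENNReal.ofReal_mul (by positivity)]; congr 1; field_simp
      _ ≤ _ := mul_le_mul' (ENNReal.ofReal_le_ofReal (le_max_right _ _)) hs1
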